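/- Let $(\mathcal X,\Sigma)$ be a measurable space in which all singletons are measurable, and let $\mathcal H$ be a class of measurable functions $h:\mathcal X\to\{0,1\}$ of finite VC dimension $d_{\mathcal H}$ (the largest number of points on which $\mathcal H$ realizes every $0$-$1$ labelling). Assume the usual measurability proviso: for every $m$ and $b\in\{0,1\}^m$, the set of $(x_1,\dots,x_m)$ such that some $h\in\mathcal H$ has $h(x_i)=b_i$ for all $i$ is measurable up to null sets of $\mu^{m}$, for every probability distribution $\mu$. Definitions. For probability distributions $\mu_0,\mu_1$ on $(\mathcal X,\Sigma)$ let $R_{\mu_0}(h)=\mu_0(h=1)$, $R_{\mu_1}(h)=\mu_1(h=0)$, $\mathcal H_{\alpha}(\mu_0)=\{h\in\mathcal H: R_{\mu_0}(h)\le\alpha\}$, and $\mathcal E_\alpha(g)=\max\{0,\,R_{\mu_1}(g)-\inf_{h\in\mathcal H_\alpha(\mu_0)}R_{\mu_1}(h)\}$. A class $\mathcal G$ admits a maximal element if some $h\in\mathcal G$ satisfies $\{h'=1\}\subseteq\{h=1\}$ for all $h'\in\mathcal G$. $\mathcal H$ separates three points if there are $h_1,h_2\in\mathcal H$ and $x_0,x_1,x_2\in\mathcal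 X$ with $h_1(x_0)=h_2(x_0)=0$, $h_1(x_1)=h_2(x_2)=1$ and $h_1(x_2)=h_2(x_1)=0$. Let $n_0(\epsilon,\delta)$ be the minimum sample size $m\ge1$ such that for every $\mu$, with $\hat\mu$ the empirical distribution of an i.i.d. sample of size $m$ from $\mu$, $\mathbb P(\sup_{h\in\mathcal H}|\hat\mu(h=1)-\mu(h=1)|>\epsilon)\le\delta$. Let $\mathcal U$ be the set of all pairs $(\mu_0,\mu_1)$ such that $\mathcal H_\alpha(\mu_0)\ne\emptyset$. An $(\epsilon_0,\delta_0)$-approximate $\alpha$-learner is a map $\hat h$ from pairs of independent i.i.d. samples $S_{\mu_0}\sim\mu_0^{n_0}$, $S_{\mu_1}\sim\mu_1^{n}$ to $\mathcal H$ such that, for all $(\mu_0,\mu_1)\in\mathcal U$, $\hat h\in\mathcal H_{\alpha+\epsilon_0}(\mu_0)$ with probability at least $1-\delta_0$. (Where measurability fails, probability of a failure event means outer probability and expectation means outer expectation.) Theorem. There are universal constants $c,C>0$ such that the following holds for all such $(\mathcal X,\Sigma)$ and $\mathcal H$, all $0<\alpha<\frac12$, $0<\delta_0<\frac12$, all $\epsilon_0>0$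 with $d_{\mathcal H}\,\epsilon_0\le\alpha$ and $\alpha+2\epsilon_0<\frac12$, for $n_0=n_0(\frac{\epsilon_0}2,\delta_0)$, and all $n\ge 2d_{\mathcal H}$. Write $$M=\inf_{\hat h}\ \sup_{(\mu_0,\mu_1)\in\mathcal U}\ \mathbb E_{S_{\mu_0},S_{\mu_1}}\Big[\mathcal E_\alpha(\hat h)\cdot\mathbb 1\{\hat h\in\mathcal H_{\alpha+\epsilon_0}(\mu_0)\}\Big],$$ where $\hat h$ ranges over the $(\epsilon_0,\delta_0)$-approximate $\alpha$-learners. (i) If $\mathcal H$ separates three points, then $$c\sqrt{\frac{d_{\mathcal H}}n}\ \le\ M\ \le\ C\sqrt{\frac{d_{\mathcal H}}n\log n}+\delta_0 .$$ (ii) Suppose $\mathcal H$ does not separate three points. (a) If there is a finitely supported distribution $\mu_0$ such that $\mathcal H_{\alpha+\epsilon_0}(\mu_0)$ is nonempty and admits no maximal element, then $$c\,\frac{d_{\mathcal H}}n\ \le\ M\ \le\ C\,\frac{d_{\mathcal H}}n\log n+\delta_0 .$$ (b) If for every finitely supported distribution $\mu_0$ with $\mathcal H_{\alpha+\epsilon_0}(\mu_0)\neq\emptyset$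 the set $\mathcal H_{\alpha+\epsilon_0}(\mu_0)$ admits a maximal element, then there is an $(\epsilon_0,\delta_0)$-approximate $\alpha$-learner $\hat h$ such that, for all $(\mu_0,\mu_1)\in\mathcal U$, with probability at least $1-\delta_0$ both $\hat h\in\mathcal H_{\alpha+\epsilon_0}(\mu_0)$ and $\mathcal E_\alpha(\hat h)=0$; in particular $$\mathbb P\big(\mathcal E_\alpha(\hat h)\cdot\mathbb 1\{\hat h\in\mathcal H_{\alpha+\epsilon_0}(\mu_0)\}=0\big)\ge 1-\delta_0 .$$ -/

import Mathlib

open MeasureTheory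
open scoped ENNReal

namespace NeymanPearson

variable {X : Type*}

/-! ### Hypothesis classes: sets of functions `X → {0, 1}`, with `1 = true` and `0 = false` -/

/-- `H` shatters the finite set of points `s`: every `0`-`1` labelling of `s` is realized. -/
def Shatters (H : Set (X → Bool)) (s : Finset X) : Prop :=
  ∀ b : X → Bool, ∃ h ∈ H, ∀ x ∈ s, h x = b x

/-- `H` has (finite) VC dimension `d`: the largest number of points that `H` shatters is `d`.
In particular `H` is nonempty (the empty set of points has to be shattered). -/
def HasVCDim (H : Set (X → Bool)) (d : ℕ) : Prop :=
  IsGreatest {m : ℕ | ∃ s : Finset X, s.card = m ∧ Shatters H s} d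

/-- `G` admits a maximal element: some `h ∈ G` with `{h' = 1} ⊆ {h = 1}` for all `h' ∈ G`. -/
def AdmitsMaximal (G : Set (X → Bool)) : Prop :=
  ∃ h ∈ G, ∀ h' ∈ G, {x | h' x = true} ⊆ {x | h x = true}

/-- Three-points-separation. -/
def SeparatesThreePoints (H : Set (X → Bool)) : Prop :=
  ∃ h₁ ∈ H, ∃ h₂ ∈ H, ∃ x₀ x₁ x₂ : X,
    (h₁ x₀ = false ∧ h₂ x₀ = false) ∧
    (h₁ x₁ = true ∧ h₂ x₂ = true ∧ h₁ x₂ = false ∧ h₂ x₁ = false)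

/-- The empirical `μ₀`-risk on a sample `S` of size `m`: the fraction of points with `h = 1`. -/
noncomputable def empRisk₀ {m : ℕ} (S : Fin m → X) (h : X → Bool) : ℝ :=
  (∑ i, if h (S i) = true then (1 : ℝ) else 0) / m

variable [MeasurableSpace X]

/-- The law of an i.i.d. sample of size `m` from `μ`. -/
noncomputable def iid (μ : ProbabilityMeasure X) (m : ℕ) : Measure (Fin m → X) :=
  Measure.pi fun _ => (μ : Measure X)

/-- The usual measurability proviso on a VC class: for every finite pattern of labels, the set of
samples on which some `h ∈ H` realizes that pattern is measurable, up to a null set, for the law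
of an i.i.d. sample. It holds e.g. for countable classes, for pointwise separable classes and for
image admissible Suslin classes. -/
def TraceMeasurable (H : Set (X → Bool)) : Prop :=
  ∀ (μ : ProbabilityMeasure X) (m : ℕ) (b : Fin m → Bool),
    NullMeasurableSet {S : Fin m → X | ∃ h ∈ H, ∀ i, h (S i) = b i} (iid μ m)

/-- A hypothesis class of finite VC dimension `d`: its members are measurable functions. -/
structure IsVCClass (H : Set (X → Bool)) (d : ℕ) : Prop where
  measurable : ∀ h ∈ H, Measurable h
  traceMeasurable : TraceMeasurable H
  hasVCDim : HasVCDim H d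

/-- `R_{μ₀}(h) = μ₀(h = 1)`. -/
noncomputable def risk₀ (μ₀ : ProbabilityMeasure X) (h : X → Bool) : ℝ :=
  (μ₀ : Measure X).real {x | h x = true}

/-- `R_{μ₁}(h) = μ₁(h = 0)`. -/
noncomputable def risk₁ (μ₁ : ProbabilityMeasure X) (h : X → Bool) : ℝ :=
  (μ₁ : Measure X).real {x | h x = false}

/-- `H_α(μ₀)`, the hypotheses in `H` of `μ₀`-risk at most `α`. -/
def level (H : Set (X → Bool)) (α : ℝ) (μ₀ : ProbabilityMeasure X) : Set (X → Bool) :=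
  {h ∈ H | risk₀ μ₀ h ≤ α}

/-- The `μ₁`-excess-risk at level `α`:
`max (0, R_{μ₁}(g) - inf {R_{μ₁}(h) : h ∈ H_α(μ₀)})`. -/
noncomputable def excessRisk (H : Set (X → Bool)) (α : ℝ) (μ₀ μ₁ : ProbabilityMeasure X)
    (g : X → Bool) : ℝ :=
  max 0 (risk₁ μ₁ g - sInf (risk₁ μ₁ '' level H α μ₀))

/-- `μ` has finite support. -/
def FinitelySupported (μ : ProbabilityMeasure X) : Prop :=
  ∃ T : Finset X, (μ : Measure X) (T : Set X)ᶜ = 0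

/-- The family `𝒰` of all pairs `(μ₀, μ₁)` such that `H_α(μ₀)` is nonempty. -/
def pairs (H : Set (X → Bool)) (α : ℝ) : Set (ProbabilityMeasure X × ProbabilityMeasure X) :=
  {p | (level H α p.1).Nonempty}

/-- `n₀(ε, δ)`: the least sample size `m ≥ 1` such that, for every `μ`, the (outer) probability
that `sup_{h ∈ H} |R̂_μ(h) - R_μ(h)| > ε` is at most `δ`. -/
noncomputable def sampleSize (H : Set (X → Bool)) (ε δ : ℝ) : ℕ :=
  sInf {m : ℕ | 0 < m ∧ ∀ μ : ProbabilityMeasure X,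
    iid μ m {S | ∃ h ∈ H, ε < |empRisk₀ S h - risk₀ μ h|} ≤ ENNReal.ofReal δ}

/-- The joint law of two independent i.i.d. samples, of size `m` from `μ₀` and `n` from `μ₁`. -/
noncomputable def samples (μ₀ μ₁ : ProbabilityMeasure X) (m n : ℕ) :
    Measure ((Fin m → X) × (Fin n → X)) :=
  (iid μ₀ m).prod (iid μ₁ n)

/-- `(ε₀, δ₀)`-approximate `α`-learners: maps from pairs of samples to `H` that return an element of
`H_{α+ε₀}(μ₀)` with probability at least `1 - δ₀`, for all `(μ₀, μ₁) ∈ 𝒰`. (No measurability is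
imposed on the map; the measure of the failure event is an outer measure.) -/
def approxLearners (H : Set (X → Bool)) (α ε₀ δ₀ : ℝ) (m n : ℕ) :
    Set ((Fin m → X) × (Fin n → X) → H) :=
  {hhat | ∀ p ∈ pairs H α,
    samples p.1 p.2 m n {S | (hhat S : X → Bool) ∉ level H (α + ε₀) p.1} ≤ ENNReal.ofReal δ₀}

/-- The outer expectation of a nonnegative function; for a measurable function it is `∫⁻`. -/
noncomputable def outerExp {Ω : Type*} [MeasurableSpace Ω] (P : Measure Ω) (f : Ω → ℝ≥0∞) :
    ℝ≥0∞ :=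
  ⨅ (g : Ω → ℝ≥0∞) (_ : Measurable g) (_ : ∀ ω, f ω ≤ g ω), ∫⁻ ω, g ω ∂P

/-- The minimax risk over the `(ε₀, δ₀)`-approximate `α`-learners:
`inf_ĥ sup_{(μ₀, μ₁) ∈ 𝒰} E [ excess risk of ĥ at level α · 1{ĥ ∈ H_{α+ε₀}(μ₀)} ]`. -/
noncomputable def minimaxRisk (H : Set (X → Bool)) (α ε₀ δ₀ : ℝ) (m n : ℕ) : ℝ≥0∞ :=
  ⨅ hhat ∈ approxLearners H α ε₀ δ₀ m n, ⨆ p ∈ pairs H α,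
    outerExp (samples p.1 p.2 m n)
      (Set.indicator {S | (hhat S : X → Bool) ∈ level H (α + ε₀) p.1}
        fun S => ENNReal.ofReal (excessRisk H α p.1 p.2 (hhat S)))

end NeymanPearson

/-! Everything turns on nestedness. For `β < 1/2` two members of `level H β μ` have a common zero,
because their one-sets have total mass below 1. If `H` does not separate three points, their zero
sets are then comparable, so level sets are chains and learning over them is a noiseless problem. A
three-point separation instead leaves a noisy choice between incomparable hypotheses.

Upper bounds. The learner minimizes the empirical `μ₁`-risk over the empirical level set at `α +
ε₀/2`. By the choice of `n₀`, outside an event of probability `δ₀`, this set lies between `H_α(μ₀)`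
and `H_{α+ε₀}(μ₀)`; the summand `δ₀` pays for that event. For general classes,
`iid_uniform_deviation_le` gives the rate `√(d log n / n)`. On a chain, the minimizer can lose to a
competitor only on a difference set that the second sample misses, and the ε-net bound
`iid_missed_difference_le` gives `d log n / n`. Both tails come from symmetrization by random swaps,
Sauer's lemma and a count of swaps.

Lower bound under separation. Take `k` of order `d` pairs of points such that `H`, while vanishing
at a base point, realizes every selection of one point per pair. Under `μ₀` all paired points weigh
about `α/k`, so a feasible hypothesis can label at most `k` of them with 1; under `μ₁` the selected
point of each pair is slightly heavier. Finding the selection is `k` coin-testing problems, and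
Assouad's lemma gives `√(k/n)` (`le_minimaxRisk_of_pairs`).

Without separation, `exists_level_eq` shows that a nonempty level set of a finitely supported
distribution, at any level below `1/2`, consists of the hypotheses vanishing at two points `t`, `s`;
conversely every such set is a level set of `twoPoint t s`, at all levels in `[0, 1/2)` at once. If
one of these chains has no maximal element, a learner that sees only `t` and `s` has finitely many
outputs, and some member of the chain is 1 at a point where all of them are 0; hiding mass of order
`1/n` there costs `1/n`, which is `d/n` since `d ≤ 2`. If all have maximal elements, so does every
nonempty empirical level set, and returning it leaves no excess risk. -/

namespace NeymanPearson

/-! ### Finitely supported distributions -/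

section Discrete

variable {X ι : Type*} [MeasurableSpace X] [Fintype ι]

/-- The distribution with weight `w i` at the point `pt i`. -/
noncomputable def discrete (w : ι → ℝ) (hw : ∀ i, 0 ≤ w i) (hw₁ : ∑ i, w i = 1) (pt : ι → X) :
    ProbabilityMeasure X :=
  ⟨∑ i, ENNReal.ofReal (w i) • Measure.dirac (pt i), ⟨by
    simp [Measure.finsetSum_apply, ← ENNReal.ofReal_sum_of_nonneg fun i _ => hw i, hw₁]⟩⟩

variable {w : ι → ℝ} {hw : ∀ i, 0 ≤ w i} {hw₁ : ∑ i, w i = 1} {pt : ι → X}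

variable [MeasurableSingletonClass X]

open Classical in
theorem discrete_real (A : Set X) :
    ((discrete w hw hw₁ pt : ProbabilityMeasure X) : Measure X).real A =
      ∑ i, if pt i ∈ A then w i else 0 := by
  have h : ((discrete w hw hw₁ pt : ProbabilityMeasure X) : Measure X) A =
      ENNReal.ofReal (∑ i, if pt i ∈ A then w i else 0) := by
    rw [ENNReal.ofReal_sum_of_nonneg fun i _ => by split_ifs <;> simp [hw]]
    change (∑ i, ENNReal.ofReal (w i) • Measure.dirac (pt i) : Measure X) A = _
    simp only [Measure.finsetSum_apply, Measure.smul_apply, Measure.dirac_apply, smul_eq_mul]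
    refine Finset.sum_congr rfl fun i _ => ?_
    by_cases h : pt i ∈ A <;> simp [h]
  rw [Measure.real, h, ENNReal.toReal_ofReal]
  exact Finset.sum_nonneg fun i _ => by split_ifs <;> simp [hw]

theorem risk₀_discrete (h : X → Bool) :
    risk₀ (discrete w hw hw₁ pt) h = ∑ i, if h (pt i) = true then w i else 0 := by
  rw [risk₀, discrete_real]
  refine Finset.sum_congr rfl fun i _ => ?_
  by_cases hi : h (pt i) = true <;> simp [hi]

theorem risk₁_discrete (h : X → Bool) :
    risk₁ (discrete w hw hw₁ pt) h = ∑ i, if h (pt i) = false then w i else 0 := by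
  rw [risk₁, discrete_real]
  refine Finset.sum_congr rfl fun i _ => ?_
  by_cases hi : h (pt i) = false <;> simp [hi]

theorem discrete_real_singleton (hpt : pt.Injective) (i : ι) :
    ((discrete w hw hw₁ pt : ProbabilityMeasure X) : Measure X).real {pt i} = w i := by
  classical
  rw [discrete_real]
  simp [hpt.eq_iff]

open Classical in
theorem finitelySupported_discrete : FinitelySupported (discrete w hw hw₁ pt) := by
  refine ⟨Finset.univ.image pt, ?_⟩
  rw [← measureReal_eq_zero_iff, discrete_real]
  exact Finset.sum_eq_zero fun i _ => if_neg fun h => h (by simp)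

end Discrete

/-- The distribution putting mass `1/2` at `t` and at `s` (mass `1` at `t` if `s = t`). -/
noncomputable def twoPoint {X : Type*} [MeasurableSpace X] (t s : X) : ProbabilityMeasure X :=
  discrete (fun _ : Bool => 1 / 2) (fun _ => by norm_num) (by simp) fun b => if b then t else s

/-! ### Classes that do not separate three points -/

section Laminar

variable {X : Type*} {H : Set (X → Bool)}

/-- Points witnessing that neither zero set contains the other, together with the common zero, are
exactly a three-point separation. -/
theorem nested_of_common_zero (hH : ¬ SeparatesThreePoints H) {h h' : X → Bool} (hh : h ∈ H)
    (hh' : h' ∈ H) {x : X} (hx : h x = false) (hx' : h' x = false) :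
    (∀ y, h y = false → h' y = false) ∨ ∀ y, h' y = false → h y = false := by
  by_contra! hcon
  obtain ⟨⟨y, hy, hy'⟩, z, hz, hz'⟩ := hcon
  simp only [ne_eq, Bool.not_eq_false] at hy' hz'
  exact hH ⟨h, hh, h', hh', x, z, y, ⟨hx, hx'⟩, hz', hy', hy, hz⟩

/-- On three shattered points, the indicators of two of them separate the three. This is why the
rate `d/n` is just `1/n` in the nested case. -/
theorem card_le_two_of_shatters (hH : ¬ SeparatesThreePoints H) {s : Finset X}
    (hs : Shatters H s) : s.card ≤ 2 := by
  classical
  by_contra! hcard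
  obtain ⟨a, b, c, ha, hb, hc, hab, hac, hbc⟩ := Finset.two_lt_card_iff.1 hcard
  obtain ⟨h₁, hh₁, e₁⟩ := hs fun x => decide (x = a)
  obtain ⟨h₂, hh₂, e₂⟩ := hs fun x => decide (x = b)
  refine hH ⟨h₁, hh₁, h₂, hh₂, c, a, b, ⟨?_, ?_⟩, ?_, ?_, ?_, ?_⟩ <;>
    simp [e₁ _ ha, e₁ _ hb, e₁ _ hc, e₂ _ ha, e₂ _ hb, e₂ _ hc, hab, hac.symm, hbc.symm, hab.symm]

theorem one_le_of_ne {d : ℕ} (hd : HasVCDim H d) {h h' : X → Bool} (hh : h ∈ H) (hh' : h' ∈ H)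
    {x : X} (hx : h x ≠ h' x) : 1 ≤ d := by
  refine hd.2 ⟨{x}, rfl, fun b => ?_⟩
  by_cases hb : h x = b x
  · exact ⟨h, hh, by simpa using hb⟩
  · refine ⟨h', hh', ?_⟩
    simp only [Finset.mem_singleton, forall_eq]
    revert hx hb
    cases h x <;> cases h' x <;> cases b x <;> simp

variable [MeasurableSpace X]

theorem risk₀_nonneg (μ : ProbabilityMeasure X) (h : X → Bool) : 0 ≤ risk₀ μ h := measureReal_nonneg

theorem exists_common_zero {β : ℝ} (hβ : β < 1 / 2) {μ : ProbabilityMeasure X} {h h' : X → Bool}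
    (hh : h ∈ level H β μ) (hh' : h' ∈ level H β μ) : ∃ x, h x = false ∧ h' x = false := by
  by_contra! hcon
  have hu : (Set.univ : Set X) ⊆ {x | h x = true} ∪ {x | h' x = true} := fun x _ => by
    by_cases hx : h x = true
    · exact Or.inl hx
    · exact Or.inr (by simpa using hcon x (by simpa using hx))
  have h₁ := measureReal_mono (μ := (μ : Measure X)) hu
  have h₂ := measureReal_union_le (μ := (μ : Measure X)) {x | h x = true} {x | h' x = true}
  have h₃ := hh.2
  have h₄ := hh'.2
  simp only [risk₀] at h₃ h₄
  simp only [probReal_univ] at h₁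
  linarith

theorem level_nested (hH : ¬ SeparatesThreePoints H) {β : ℝ} (hβ : β < 1 / 2)
    {μ : ProbabilityMeasure X} {h h' : X → Bool} (hh : h ∈ level H β μ) (hh' : h' ∈ level H β μ) :
    (∀ y, h y = false → h' y = false) ∨ ∀ y, h' y = false → h y = false :=
  let ⟨_, hx, hx'⟩ := exists_common_zero hβ hh hh'
  nested_of_common_zero hH hh.1 hh'.1 hx hx'

theorem risk₀_mono_of_support {μ : ProbabilityMeasure X} {T : Finset X}
    (hT : (μ : Measure X) (T : Set X)ᶜ = 0) {h h' : X → Bool}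
    (hle : ∀ x ∈ T, h x = true → h' x = true) : risk₀ μ h ≤ risk₀ μ h' := by
  have hsub : {x | h x = true} ⊆ {x | h' x = true} ∪ (T : Set X)ᶜ := fun x hx => by
    by_cases hxT : x ∈ T
    · exact Or.inl (hle x hxT hx)
    · exact Or.inr (by simpa using hxT)
  have h₁ := measureReal_mono (μ := (μ : Measure X)) hsub
  have h₂ := measureReal_union_le (μ := (μ : Measure X)) {x | h' x = true} (T : Set X)ᶜ
  have h₃ : (μ : Measure X).real (T : Set X)ᶜ = 0 := by simp [Measure.real, hT]
  simp only [risk₀]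
  linarith

/-- In a class that does not separate three points, the hypotheses of small risk under a finitely
supported distribution are those that vanish at two well-chosen points. -/
theorem exists_level_eq (hH : ¬ SeparatesThreePoints H) {β : ℝ} (hβ : β < 1 / 2)
    {μ : ProbabilityMeasure X} (hμ : FinitelySupported μ) (hne : (level H β μ).Nonempty) :
    ∃ t s, level H β μ = {h ∈ H | h t = false ∧ h s = false} := by
  classical
  obtain ⟨T, hT⟩ := hμ
  let tr : (X → Bool) → Finset X := fun h => T.filter fun x => h x = false
  obtain ⟨h₀, hh₀, hmin⟩ : ∃ h₀ ∈ level H β μ, ∀ h ∈ level H β μ, (tr h₀).card ≤ (tr h).card := by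
    obtain ⟨h₀, hh₀⟩ := hne
    obtain ⟨h₁, hh₁, e⟩ := exists_minimalFor_of_wellFoundedLT (· ∈ level H β μ)
      (fun h => (tr h).card) ⟨h₀, hh₀⟩
    exact ⟨h₁, hh₁, fun h hh => (le_total _ _).elim id fun hle => e hh hle⟩
  -- members of the level set vanish on the minimal trace
  have hsub : ∀ h ∈ level H β μ, tr h₀ ⊆ tr h := by
    intro h hh
    rcases level_nested hH hβ hh₀ hh with hle | hle
    · exact Finset.monotone_filter_right _ fun x _ hx => hle x hx
    · have : tr h ⊆ tr h₀ := Finset.monotone_filter_right _ fun x _ hx => hle x hx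
      exact (Finset.eq_of_subset_of_card_le this (hmin h hh)).ge
  have hlevel : ∀ h ∈ H, tr h₀ ⊆ tr h → h ∈ level H β μ := by
    intro h hh hle
    refine ⟨hh, (risk₀_mono_of_support hT fun x hxT hx => ?_).trans hh₀.2⟩
    by_contra hx₀
    have := hle (Finset.mem_filter.2 ⟨hxT, by simpa using hx₀⟩)
    simp [tr, hx] at this
  -- With an empty trace, `h₀` would be 1 on the whole support and have risk 1.
  obtain ⟨t, ht⟩ : (tr h₀).Nonempty := by
    by_contra hcon
    rw [Finset.not_nonempty_iff_eq_empty, Finset.filter_eq_empty_iff] at hcon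
    have h₁ : (1 : ℝ) ≤ risk₀ μ h₀ := by
      have := risk₀_mono_of_support (h := fun _ => true) (h' := h₀) hT
        fun x hx _ => by simpa using hcon hx
      simpa [risk₀] using this
    have := hh₀.2
    linarith
  by_cases hex : ∃ h ∈ H, h t = false ∧ ¬ tr h₀ ⊆ tr h
  · -- a hypothesis with maximal proper trace among those vanishing at `t`
    obtain ⟨g, ⟨hg, hgt, hgs⟩, hmax⟩ : ∃ g, (g ∈ H ∧ g t = false ∧ ¬ tr h₀ ⊆ tr g) ∧
        ∀ h, (h ∈ H ∧ h t = false ∧ ¬ tr h₀ ⊆ tr h) → (tr h).card ≤ (tr g).card := by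
      obtain ⟨h, hh⟩ := hex
      obtain ⟨g, hg, e⟩ := exists_minimalFor_of_wellFoundedLT
        (fun h => h ∈ H ∧ h t = false ∧ ¬ tr h₀ ⊆ tr h) (fun h => T.card - (tr h).card) ⟨h, hh⟩
      refine ⟨g, hg, fun h hh => ?_⟩
      have h₁ : (tr h).card ≤ T.card := Finset.card_filter_le _ _
      have h₂ : (tr g).card ≤ T.card := Finset.card_filter_le _ _
      have h₃ : T.card - (tr h).card ≤ T.card - (tr g).card →
        T.card - (tr g).card ≤ T.card - (tr h).card := fun hle => e hh hle
      omega
    obtain ⟨s, hs, hsg⟩ := Finset.not_subset.1 hgs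
    have hs' := (Finset.mem_filter.1 hs)
    refine ⟨t, s, Set.ext fun h => ⟨fun hh => ⟨hh.1, ?_, ?_⟩, fun ⟨hh, h1, h2⟩ => hlevel h hh ?_⟩⟩
    · exact (Finset.mem_filter.1 (hsub h hh ht)).2
    · exact (Finset.mem_filter.1 (hsub h hh hs)).2
    -- Both `h` and `g` vanish at `t`, hence are comparable. If `h` has the smaller zero set, then
    -- `g` vanishes at `s`; if `g` does, maximality makes the traces equal. Either way `s` lies in
    -- the trace of `g`, against its choice.
    · by_contra hn
      rcases nested_of_common_zero hH hh hg h1 hgt with hle | hle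
      · exact hsg (Finset.mem_filter.2 ⟨hs'.1, hle s h2⟩)
      · have hle' : tr g ⊆ tr h := Finset.monotone_filter_right _ fun x _ hx => hle x hx
        rw [Finset.eq_of_subset_of_card_le hle' (hmax h ⟨hh, h1, hn⟩)] at hsg
        exact hsg (Finset.mem_filter.2 ⟨hs'.1, h2⟩)
  · push Not at hex
    refine ⟨t, t, Set.ext fun h => ⟨fun hh => ⟨hh.1, ?_, ?_⟩, fun ⟨hh, h1, _⟩ =>
      hlevel h hh (hex h hh h1)⟩⟩ <;>
    exact (Finset.mem_filter.1 (hsub h hh ht)).2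

/-- A one at either point already costs at least `1/2 > β`. As the right side does not involve `β`,
this allows a change of level. -/
theorem level_twoPoint [MeasurableSingletonClass X] {β : ℝ} (h₀ : 0 ≤ β) (hβ : β < 1 / 2)
    (t s : X) : level H β (twoPoint t s) = {h ∈ H | h t = false ∧ h s = false} := by
  ext h
  simp only [level, twoPoint, risk₀_discrete, Set.mem_ofPred_eq, Fintype.sum_bool, if_true,
    Bool.false_eq_true, if_false]
  refine and_congr_right fun _ => ?_
  cases h t <;> cases h s <;> simp <;> linarith

end Laminar

/-! ### Uniform deviations over VC classes -/

section Chebyshev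

variable {X : Type*} [MeasurableSpace X]

instance (μ : ProbabilityMeasure X) (m : ℕ) : IsProbabilityMeasure (iid μ m) := by
  unfold iid; infer_instance

-- Chebyshev's inequality, with the variance bounded by the risk itself rather than by a constant:
-- the ε-net bound needs this at deviations proportional to the risk.
open ProbabilityTheory in
theorem iid_deviation_le (μ : ProbabilityMeasure X) {f : X → Bool} (hf : Measurable f) {m : ℕ}
    (hm : 0 < m) {s : ℝ} (hs : 0 < s) :
    iid μ m {S | s ≤ |empRisk₀ S f - risk₀ μ f|} ≤ ENNReal.ofReal (risk₀ μ f / (m * s ^ 2)) := by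
  have hm' : (0 : ℝ) < m := by exact_mod_cast hm
  let Y : X → ℝ := fun x => if f x = true then 1 else 0
  have hset : MeasurableSet {x | f x = true} := hf (measurableSet_singleton true)
  have hY : Measurable Y := Measurable.ite hset measurable_const measurable_const
  have hYb : ∀ x, Y x ∈ Set.Icc (0 : ℝ) 1 := fun x => by
    simp only [Y]; split_ifs <;> simp
  have hYL : MemLp Y 2 (μ : Measure X) :=
    memLp_of_bounded (Filter.Eventually.of_forall hYb) hY.aestronglyMeasurable 2
  have hEY : ∫ x, Y x ∂(μ : Measure X) = risk₀ μ f := by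
    have : Y = Set.indicator {x | f x = true} 1 := by
      ext x; simp [Y, Set.indicator]
    rw [this, integral_indicator_one hset, risk₀]
  have hp0 := risk₀_nonneg μ f
  have hVar : Var[Y; (μ : Measure X)] ≤ risk₀ μ f := by
    have := variance_le_sub_mul_sub (Filter.Eventually.of_forall hYb) hY.aemeasurable
      (μ := (μ : Measure X))
    rw [hEY] at this
    nlinarith
  let Z : (Fin m → X) → ℝ := ∑ i, fun S : Fin m → X => Y (S i)
  have hYi : ∀ i : Fin m, MemLp (fun S : Fin m → X => Y (S i)) 2 (iid μ m) := fun i =>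
    hYL.comp_measurePreserving (measurePreserving_eval _ i)
  have hZL : MemLp Z 2 (iid μ m) := memLp_finsetSum' _ fun i _ => hYi i
  have hEZ : ∫ S, Z S ∂iid μ m = m * risk₀ μ f := by
    have : ∀ i : Fin m, ∫ S, Y (S i) ∂iid μ m = risk₀ μ f := fun i => by
      rw [← hEY]
      exact integral_comp_eval (μ := fun _ : Fin m => (μ : Measure X)) hY.aestronglyMeasurable
    simp only [Z, Finset.sum_apply]
    rw [integral_finsetSum _ fun i _ => (hYi i).integrable (by norm_num)]
    simp [this]
  have hVZ : Var[Z; iid μ m] ≤ m * risk₀ μ f := by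
    have := variance_sum_pi (μ := fun _ : Fin m => (μ : Measure X)) (X := fun _ => Y) fun _ => hYL
    have e : Var[Z; iid μ m] = ∑ _i : Fin m, Var[Y; (μ : Measure X)] := this
    rw [e, Finset.sum_const, Finset.card_univ, Fintype.card_fin, nsmul_eq_mul]
    gcongr
  have key := meas_ge_le_variance_div_sq hZL (c := m * s) (by positivity)
  rw [hEZ] at key
  refine (measure_mono fun S hS => ?_).trans (key.trans (ENNReal.ofReal_le_ofReal ?_))
  · have hZS : Z S = m * empRisk₀ S f := by
      simp only [Z, Finset.sum_apply, empRisk₀, Y]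
      field_simp
    have hS' : s ≤ |empRisk₀ S f - risk₀ μ f| := hS
    change m * s ≤ |Z S - m * risk₀ μ f|
    rw [hZS, ← mul_sub, abs_mul, abs_of_pos hm']
    gcongr
  · calc Var[Z; iid μ m] / (m * s) ^ 2 ≤ m * risk₀ μ f / (m * s) ^ 2 := by gcongr
      _ = _ := by field_simp

end Chebyshev

/-! #### Traces and Sauer's lemma -/

section Sauer

theorem sum_choose_le_pow (N d : ℕ) : ∑ k ∈ Finset.Iic d, N.choose k ≤ (N + 1) ^ d := by
  induction d with
  | zero => simp [show Finset.Iic 0 = {0} from rfl]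
  | succ d ih =>
    rw [← Nat.range_succ_eq_Iic, Finset.sum_range_succ, Nat.range_succ_eq_Iic]
    have h : N.choose (d + 1) ≤ N ^ (d + 1) := Nat.choose_le_pow _ _
    have h' : N ^ d ≤ (N + 1) ^ d := Nat.pow_le_pow_left (by omega) d
    calc _ ≤ (N + 1) ^ d + N ^ (d + 1) := add_le_add ih h
      _ ≤ (N + 1) ^ d + N * (N + 1) ^ d := by rw [pow_succ, mul_comm _ N]; gcongr
      _ = _ := by ring

variable {X ι : Type*} [Fintype ι] [DecidableEq ι]

open Classical in
/-- The labellings that `H` induces on the points `z`. -/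
noncomputable def traces (H : Set (X → Bool)) (z : ι → X) : Finset (ι → Bool) :=
  Finset.univ.filter fun b => ∃ h ∈ H, ∀ i, h (z i) = b i

/-- Sauer–Shelah for the family of supports of the traces. The points `z` may repeat, but `z` is
injective on a shattered set of indices, so such a set yields equally many shattered points. -/
theorem card_traces_le {H : Set (X → Bool)} {d : ℕ} (hd : HasVCDim H d) (z : ι → X) :
    (traces H z).card ≤ (Fintype.card ι + 1) ^ d := by
  classical
  let supp : (ι → Bool) → Finset ι := fun b => Finset.univ.filter fun i => b i = true
  have hinj : Function.Injective supp := fun b b' e => by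
    ext i
    have := Finset.ext_iff.1 e i
    simp only [supp, Finset.mem_filter, Finset.mem_univ, true_and] at this
    cases hb : b i <;> cases hb' : b' i <;> simp_all
  let F : Finset (Finset ι) := (traces H z).image supp
  have hcard : (traces H z).card = F.card := (Finset.card_image_of_injective _ hinj).symm
  have hmem : ∀ u ∈ F, ∃ h ∈ H, ∀ i, h (z i) = true ↔ i ∈ u := by
    intro u hu
    obtain ⟨b, hb, rfl⟩ := Finset.mem_image.1 hu
    obtain ⟨h, hh, e⟩ := (Finset.mem_filter.1 hb).2
    exact ⟨h, hh, fun i => by simp [supp, e]⟩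
  have hvc : F.vcDim ≤ d := by
    refine Finset.sup_le fun T hT => ?_
    have hT' := Finset.mem_shatterer.1 hT
    have hzT : Set.InjOn z T := by
      intro i hi j hj hij
      by_contra hne
      obtain ⟨u, hu, e⟩ := hT' (Finset.singleton_subset_iff.2 hi)
      obtain ⟨h, _, hh⟩ := hmem u hu
      have h₁ : i ∈ u := (Finset.mem_inter.1 (e.ge (Finset.mem_singleton_self i))).2
      have h₂ : j ∉ u := fun hju =>
        hne (Finset.mem_singleton.1 (e.le (Finset.mem_inter.2 ⟨hj, hju⟩))).symm
      exact h₂ ((hh j).1 (hij ▸ (hh i).2 h₁))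
    refine hd.2 ⟨T.image z, Finset.card_image_of_injOn hzT, fun b => ?_⟩
    obtain ⟨u, hu, e⟩ := hT' (Finset.filter_subset (fun i => b (z i) = true) T)
    obtain ⟨h, hh, hhu⟩ := hmem u hu
    refine ⟨h, hh, fun x hx => ?_⟩
    obtain ⟨i, hi, rfl⟩ := Finset.mem_image.1 hx
    have := Finset.ext_iff.1 e i
    simp only [Finset.mem_inter, hi, true_and, Finset.mem_filter, ← hhu i] at this
    cases h1 : h (z i) <;> cases h2 : b (z i) <;> simp_all
  rw [hcard]
  calc F.card ≤ F.shatterer.card := Finset.card_le_card_shatterer F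
    _ ≤ ∑ k ∈ Finset.Iic F.vcDim, (Fintype.card ι).choose k := Finset.card_shatterer_le_sum_vcDim
    _ ≤ ∑ k ∈ Finset.Iic d, (Fintype.card ι).choose k :=
      Finset.sum_le_sum_of_subset (Finset.Iic_subset_Iic.2 hvc)
    _ ≤ _ := sum_choose_le_pow _ _

end Sauer

/-! #### Symmetrization -/

section Symmetrization

/-- The involution of the double sample that exchanges the `i`-th points of the two halves whenever
`σ i` holds. -/
def swapPerm {m : ℕ} (σ : Fin m → Bool) : Equiv.Perm (Fin m ⊕ Fin m) where
  toFun := Sum.elim (fun i => if σ i then .inr i else .inl i) fun i => if σ i then .inl i else .inr i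
  invFun := Sum.elim (fun i => if σ i then .inr i else .inl i) fun i => if σ i then .inl i else .inr i
  left_inv := by rintro (i | i) <;> by_cases h : σ i <;> simp [h]
  right_inv := by rintro (i | i) <;> by_cases h : σ i <;> simp [h]

variable {X : Type*} [MeasurableSpace X]

/-- The law of a double sample. -/
noncomputable def iid₂ (μ : ProbabilityMeasure X) (m : ℕ) : Measure (Fin m ⊕ Fin m → X) :=
  Measure.pi fun _ => (μ : Measure X)

instance (μ : ProbabilityMeasure X) (m : ℕ) : IsProbabilityMeasure (iid₂ μ m) := by
  unfold iid₂; infer_instance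

theorem measurePreserving_comp_equiv {ι ι' : Type*} [Fintype ι] [Fintype ι'] (e : ι' ≃ ι)
    (μ : Measure X) [SigmaFinite μ] : MeasurePreserving (fun z : ι → X => z ∘ e)
      (Measure.pi fun _ => μ) (Measure.pi fun _ => μ) := by
  have := (measurePreserving_piCongrLeft (α := fun _ : ι => X) (fun _ => μ) e).symm
  exact this

theorem measurePreserving_sumElim (μ : ProbabilityMeasure X) (m : ℕ) :
    MeasurePreserving (fun p : (Fin m → X) × (Fin m → X) => Sum.elim p.1 p.2)
      ((iid μ m).prod (iid μ m)) (iid₂ μ m) := by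
  have := measurePreserving_sumPiEquivProdPi_symm (X := fun _ : Fin m ⊕ Fin m => X)
    (fun _ => (μ : Measure X))
  convert! this using 1

/-- Symmetrization: if every sample in `B` sends at least half of the independent ghost samples into
`E`, then `B` has at most twice the measure of `E`. -/
theorem iid_le_two_mul (μ : ProbabilityMeasure X) (m : ℕ) {B : Set (Fin m → X)}
    {E : Set (Fin m ⊕ Fin m → X)}
    (h : ∀ S ∈ B, (1 / 2 : ℝ≥0∞) ≤ iid μ m {S' | Sum.elim S S' ∈ E}) :
    iid μ m B ≤ 2 * iid₂ μ m E := by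
  set P := (iid μ m).prod (iid μ m)
  let E' := (fun p : (Fin m → X) × (Fin m → X) => Sum.elim p.1 p.2) ⁻¹' toMeasurable (iid₂ μ m) E
  have hE' : MeasurableSet E' :=
    (measurePreserving_sumElim μ m).measurable (measurableSet_toMeasurable _ _)
  have hPE : P E' = iid₂ μ m E := by
    rw [(measurePreserving_sumElim μ m).measure_preimage
      (measurableSet_toMeasurable _ _).nullMeasurableSet, measure_toMeasurable]
  have hB : B ⊆ {S | (1 / 2 : ℝ≥0∞) ≤ iid μ m (Prod.mk S ⁻¹' E')} := fun S hS =>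
    (h S hS).trans (measure_mono fun S' hS' => subset_toMeasurable _ _ hS')
  have key := mul_meas_ge_le_lintegral (μ := iid μ m)
    (measurable_measure_prodMk_left (ν := iid μ m) hE') (1 / 2)
  rw [← Measure.prod_apply hE', hPE] at key
  calc iid μ m B ≤ iid μ m {S | (1 / 2 : ℝ≥0∞) ≤ iid μ m (Prod.mk S ⁻¹' E')} := measure_mono hB
    _ = 2 * (1 / 2 * iid μ m {S | (1 / 2 : ℝ≥0∞) ≤ iid μ m (Prod.mk S ⁻¹' E')}) := by
      rw [← mul_assoc, one_div, ENNReal.mul_inv_cancel (by norm_num) (by norm_num), one_mul]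
    _ ≤ _ := by gcongr

/-- The double samples on which some pair of members of `H` has labels related by `P`. -/
def pairEvent (H : Set (X → Bool)) (m : ℕ)
    (P : (Fin m ⊕ Fin m → Bool) → (Fin m ⊕ Fin m → Bool) → Prop) : Set (Fin m ⊕ Fin m → X) :=
  {z | ∃ h ∈ H, ∃ h' ∈ H, P (h ∘ z) (h' ∘ z)}

theorem TraceMeasurable.nullMeasurableSet_sum {H : Set (X → Bool)} (hH : TraceMeasurable H)
    (μ : ProbabilityMeasure X) (m : ℕ) (b : Fin m ⊕ Fin m → Bool) :
    NullMeasurableSet {z : Fin m ⊕ Fin m → X | ∃ h ∈ H, ∀ i, h (z i) = b i} (iid₂ μ m) := by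
  have hpre := (hH μ (m + m) (b ∘ finSumFinEquiv.symm)).preimage
    (measurePreserving_comp_equiv finSumFinEquiv.symm (μ : Measure X)).quasiMeasurePreserving
  change NullMeasurableSet _ (Measure.pi fun _ : Fin m ⊕ Fin m => (μ : Measure X))
  convert hpre using 1
  ext z
  refine exists_congr fun h => and_congr_right fun _ => ?_
  simp only [Function.comp]
  exact (Equiv.forall_congr_left finSumFinEquiv)

/-- The event depends only on which labellings are realized, so it is a finite union of
intersections of trace events. -/
theorem TraceMeasurable.nullMeasurableSet_pairEvent {H : Set (X → Bool)} (hH : TraceMeasurable H)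
    (μ : ProbabilityMeasure X) (m : ℕ)
    (P : (Fin m ⊕ Fin m → Bool) → (Fin m ⊕ Fin m → Bool) → Prop) :
    NullMeasurableSet (pairEvent H m P) (iid₂ μ m) := by
  have : pairEvent H m P = ⋃ b, ⋃ b', ⋃ _ : P b b',
      {z | ∃ h ∈ H, ∀ i, h (z i) = b i} ∩ {z | ∃ h ∈ H, ∀ i, h (z i) = b' i} := by
    ext z
    simp only [pairEvent, Set.mem_iUnion, Set.mem_inter_iff, Set.mem_ofPred_eq, exists_prop]
    constructor
    · rintro ⟨h, hh, h', hh', hP⟩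
      exact ⟨_, _, hP, ⟨h, hh, fun _ => rfl⟩, ⟨h', hh', fun _ => rfl⟩⟩
    · rintro ⟨b, b', hP, ⟨h, hh, e⟩, ⟨h', hh', e'⟩⟩
      refine ⟨h, hh, h', hh', ?_⟩
      rwa [show h ∘ z = b from funext e, show h' ∘ z = b' from funext e']
  rw [this]
  exact .iUnion fun b => .iUnion fun b' => .iUnion fun _ =>
    (hH.nullMeasurableSet_sum μ m b).inter (hH.nullMeasurableSet_sum μ m b')

open Classical in
/-- If, for each pair of labellings, at most a fraction `κ` of the swaps produces a pair related by
`P`, then the event `pairEvent H m P` has probability at most `(2m+1)^{2d} κ`. -/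
theorem iid₂_pairEvent_le {H : Set (X → Bool)} {d : ℕ} (hH : IsVCClass H d)
    (μ : ProbabilityMeasure X) (m : ℕ)
    (P : (Fin m ⊕ Fin m → Bool) → (Fin m ⊕ Fin m → Bool) → Prop) {κ : ℝ} (hκ : 0 ≤ κ)
    (hP : ∀ b b', ((Finset.univ.filter fun σ : Fin m → Bool =>
      P (b ∘ swapPerm σ) (b' ∘ swapPerm σ)).card : ℝ) ≤ 2 ^ m * κ) :
    iid₂ μ m (pairEvent H m P) ≤ ENNReal.ofReal ((2 * m + 1) ^ (2 * d) * κ) := by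
  -- A measurable subset of full measure suffices: it keeps the inclusion needed for counting and
  -- allows integration.
  obtain ⟨E, hEsub, hE, hEae⟩ :=
    (hH.traceMeasurable.nullMeasurableSet_pairEvent μ m P).exists_measurable_subset_ae_eq
  rw [← measure_congr hEae]
  have hmp : ∀ σ : Fin m → Bool, MeasurePreserving (fun z : Fin m ⊕ Fin m → X => z ∘ swapPerm σ)
      (iid₂ μ m) (iid₂ μ m) := fun σ => measurePreserving_comp_equiv (swapPerm σ) (μ : Measure X)
  -- For a fixed double sample, only the at most `(2m+1)^{2d}` pairs of traces matter, so a union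
  -- bound over them replaces the one over `H`.
  have hcount : ∀ z : Fin m ⊕ Fin m → X,
      ((Finset.univ.filter fun σ : Fin m → Bool => z ∘ swapPerm σ ∈ E).card : ℝ) ≤
        2 ^ m * ((2 * m + 1) ^ (2 * d) * κ) := by
    intro z
    have hsub : (Finset.univ.filter fun σ : Fin m → Bool => z ∘ swapPerm σ ∈ E) ⊆
        (traces H z ×ˢ traces H z).biUnion fun bb => Finset.univ.filter fun σ : Fin m → Bool =>
          P (bb.1 ∘ swapPerm σ) (bb.2 ∘ swapPerm σ) := by
      intro σ hσ
      obtain ⟨h, hh, h', hh', hPz⟩ := hEsub (Finset.mem_filter.1 hσ).2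
      refine Finset.mem_biUnion.2 ⟨(h ∘ z, h' ∘ z), ?_, ?_⟩
      · exact Finset.mem_product.2 ⟨Finset.mem_filter.2 ⟨Finset.mem_univ _, h, hh, fun _ => rfl⟩,
          Finset.mem_filter.2 ⟨Finset.mem_univ _, h', hh', fun _ => rfl⟩⟩
      · exact Finset.mem_filter.2 ⟨Finset.mem_univ _, hPz⟩
    have ht : ((traces H z).card : ℝ) ≤ (2 * m + 1) ^ d := by
      have := card_traces_le hH.hasVCDim z
      simp only [Fintype.card_sum, Fintype.card_fin, ← two_mul] at this
      exact_mod_cast this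
    calc ((Finset.univ.filter fun σ : Fin m → Bool => z ∘ swapPerm σ ∈ E).card : ℝ)
        ≤ ∑ bb ∈ traces H z ×ˢ traces H z, ((Finset.univ.filter fun σ : Fin m → Bool =>
          P (bb.1 ∘ swapPerm σ) (bb.2 ∘ swapPerm σ)).card : ℝ) := by
            exact_mod_cast (Finset.card_le_card hsub).trans Finset.card_biUnion_le
      _ ≤ ∑ bb ∈ traces H z ×ˢ traces H z, 2 ^ m * κ := Finset.sum_le_sum fun bb _ => hP _ _
      _ = (traces H z).card * (traces H z).card * (2 ^ m * κ) := by simp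
      _ ≤ (2 * m + 1) ^ d * (2 * m + 1) ^ d * (2 ^ m * κ) := by gcongr
      _ = _ := by ring
  -- Each swap preserves the law, so the measure of `E` is the mean over swaps of the indicator,
  -- which is then bounded pointwise.
  have hsum : (2 ^ m : ℝ≥0∞) * iid₂ μ m E =
      ∫⁻ z, ∑ σ : Fin m → Bool, E.indicator 1 (z ∘ swapPerm σ) ∂iid₂ μ m := by
    rw [lintegral_finsetSum (f := fun (σ : Fin m → Bool) (z : Fin m ⊕ Fin m → X) =>
      E.indicator (1 : (Fin m ⊕ Fin m → X) → ℝ≥0∞) (z ∘ swapPerm σ)) _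
      fun σ _ => (measurable_one.indicator hE).comp (hmp σ).measurable]
    have : ∀ σ : Fin m → Bool, ∫⁻ z, E.indicator 1 (z ∘ swapPerm σ) ∂iid₂ μ m = iid₂ μ m E :=
      fun σ => by
        rw [(hmp σ).lintegral_comp (measurable_one.indicator hE), lintegral_indicator_one hE]
    simp [this]
  have hle : ∀ z : Fin m ⊕ Fin m → X, ∑ σ : Fin m → Bool, E.indicator (1 : (Fin m ⊕ Fin m → X) → ℝ≥0∞)
      (z ∘ swapPerm σ) ≤ 2 ^ m * ENNReal.ofReal ((2 * m + 1) ^ (2 * d) * κ) := by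
    intro z
    have e : ∑ σ : Fin m → Bool, E.indicator (1 : (Fin m ⊕ Fin m → X) → ℝ≥0∞) (z ∘ swapPerm σ) =
        ((Finset.univ.filter fun σ : Fin m → Bool => z ∘ swapPerm σ ∈ E).card : ℝ≥0∞) := by
      rw [Finset.card_filter, Nat.cast_sum]
      refine Finset.sum_congr rfl fun σ _ => ?_
      by_cases hz : z ∘ swapPerm σ ∈ E <;> simp [hz]
    rw [e, ← ENNReal.ofReal_natCast]
    refine (ENNReal.ofReal_le_ofReal (hcount z)).trans_eq ?_
    rw [ENNReal.ofReal_mul (by positivity), ENNReal.ofReal_pow (by norm_num)]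
    simp
  have hfin := hsum.le.trans ((lintegral_mono (μ := iid₂ μ m) hle).trans_eq
    (by rw [lintegral_const, measure_univ, mul_one]))
  exact (ENNReal.mul_le_mul_iff_right (by simp) (by simp)).1 hfin

end Symmetrization

/-! ### Counting sign patterns and swaps -/

section Counting

/-- Chernoff's method: the sum of exponentials over all signs factorizes, and each factor is `2
cosh(l c i) ≤ 2 exp(l²/2)`. -/
theorem card_rademacher_le {m : ℕ} (c : Fin m → ℝ) (hc : ∀ i, |c i| ≤ 1) {l s : ℝ}
    (hl : 0 ≤ l) :
    Real.exp (l * s) * ((Finset.univ.filter fun σ : Fin m → Bool =>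
      s ≤ ∑ i, if σ i then -c i else c i).card : ℝ) ≤
      2 ^ m * Real.exp (m * l ^ 2 / 2) := by
  have h₁ : ∀ i, Real.exp (l * -c i) + Real.exp (l * c i) ≤ 2 * Real.exp (l ^ 2 / 2) := by
    intro i
    have e : Real.exp (l * -c i) + Real.exp (l * c i) = 2 * Real.cosh (l * c i) := by
      rw [Real.cosh_eq, mul_neg]; ring
    rw [e]
    have h₂ : (c i) ^ 2 ≤ 1 := by rw [← sq_abs]; exact pow_le_one₀ (abs_nonneg _) (hc i)
    have h₃ : (l * c i) ^ 2 / 2 ≤ l ^ 2 / 2 := by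
      rw [mul_pow]; nlinarith [sq_nonneg l]
    linarith [(Real.cosh_le_exp_half_sq (l * c i)).trans (Real.exp_le_exp.2 h₃)]
  have hprod : ∑ σ : Fin m → Bool, Real.exp (l * ∑ i, if σ i then -c i else c i) =
      ∏ i, (Real.exp (l * -c i) + Real.exp (l * c i)) := by
    have := Finset.prod_univ_sum (fun _ : Fin m => (Finset.univ : Finset Bool))
      fun i b => Real.exp (l * if b then -c i else c i)
    simp only [Fintype.sum_bool, if_true, Bool.false_eq_true, if_false,
      Fintype.piFinset_univ] at this
    rw [this]
    refine Finset.sum_congr rfl fun σ _ => ?_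
    rw [← Real.exp_sum, Finset.mul_sum]
  calc _ = ∑ σ ∈ Finset.univ.filter fun σ : Fin m → Bool =>
        s ≤ ∑ i, if σ i then -c i else c i, Real.exp (l * s) := by simp [mul_comm]
    _ ≤ ∑ σ ∈ Finset.univ.filter fun σ : Fin m → Bool =>
        s ≤ ∑ i, if σ i then -c i else c i, Real.exp (l * ∑ i, if σ i then -c i else c i) := by
      refine Finset.sum_le_sum fun σ hσ => Real.exp_le_exp.2 ?_
      exact mul_le_mul_of_nonneg_left (Finset.mem_filter.1 hσ).2 hl
    _ ≤ ∑ σ : Fin m → Bool, Real.exp (l * ∑ i, if σ i then -c i else c i) :=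
      Finset.sum_le_sum_of_subset_of_nonneg (Finset.subset_univ _) fun _ _ _ => (Real.exp_pos _).le
    _ = ∏ i, (Real.exp (l * -c i) + Real.exp (l * c i)) := hprod
    _ ≤ ∏ _i : Fin m, 2 * Real.exp (l ^ 2 / 2) :=
      Finset.prod_le_prod (fun i _ => by positivity) fun i _ => h₁ i
    _ = _ := by
      rw [Finset.prod_const, Finset.card_univ, Fintype.card_fin, mul_pow, ← Real.exp_nat_mul]
      ring_nf

/-- Hoeffding's inequality for signed sums, as a count of sign patterns. -/
theorem card_abs_rademacher_le {m : ℕ} (hm : 0 < m) (c : Fin m → ℝ) (hc : ∀ i, |c i| ≤ 1) {s : ℝ}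
    (hs : 0 ≤ s) :
    ((Finset.univ.filter fun σ : Fin m → Bool =>
      s ≤ |∑ i, if σ i then -c i else c i|).card : ℝ) ≤
      2 ^ m * (2 * Real.exp (-(s ^ 2 / (2 * m)))) := by
  have hm' : (0 : ℝ) < m := by exact_mod_cast hm
  have hone : ∀ c : Fin m → ℝ, (∀ i, |c i| ≤ 1) → ((Finset.univ.filter fun σ : Fin m → Bool =>
      s ≤ ∑ i, if σ i then -c i else c i).card : ℝ) ≤ 2 ^ m * Real.exp (-(s ^ 2 / (2 * m))) := by
    intro c hc
    have := card_rademacher_le c hc (l := s / m) (s := s) (by positivity)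
    rw [← mul_le_mul_iff_of_pos_left (Real.exp_pos (s / m * s))]
    refine this.trans_eq ?_
    rw [mul_left_comm, ← Real.exp_add]
    congr 2
    field_simp
    ring
  have hsub : (Finset.univ.filter fun σ : Fin m → Bool =>
      s ≤ |∑ i, if σ i then -c i else c i|) ⊆
      (Finset.univ.filter fun σ : Fin m → Bool => s ≤ ∑ i, if σ i then -c i else c i) ∪
      (Finset.univ.filter fun σ : Fin m → Bool => s ≤ ∑ i, if σ i then -(-c i) else -c i) := by
    intro σ hσ
    have e : ∑ i, (if σ i then -(-c i) else -c i) = -∑ i, if σ i then -c i else c i := by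
      rw [← Finset.sum_neg_distrib]
      exact Finset.sum_congr rfl fun i _ => by split_ifs <;> rfl
    simp only [Finset.mem_union, Finset.mem_filter, Finset.mem_univ, true_and, e] at hσ ⊢
    exact le_abs.1 hσ
  have h₁ := hone c hc
  have h₂ := hone (fun i => -c i) fun i => by rw [abs_neg]; exact hc i
  calc _ ≤ (((Finset.univ.filter fun σ : Fin m → Bool =>
          s ≤ ∑ i, if σ i then -c i else c i).card +
        (Finset.univ.filter fun σ : Fin m → Bool =>
          s ≤ ∑ i, if σ i then -(-c i) else -c i).card : ℕ) : ℝ) := by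
        exact_mod_cast (Finset.card_le_card hsub).trans (Finset.card_union_le _ _)
    _ ≤ _ := by push_cast; linarith

/-- Few swaps move all the marked points of a double sample into its second half. -/
theorem card_swap_le {m : ℕ} (a c : Fin m → Bool) {r : ℝ} :
    ((Finset.univ.filter fun σ : Fin m → Bool => (∀ i, (if σ i then c i else a i) = false) ∧
      r ≤ ((Finset.univ.filter fun i => (if σ i then a i else c i) = true).card : ℝ)).card : ℝ) ≤
      2 ^ m * Real.exp (-(r / 2)) := by
  set F := Finset.univ.filter fun σ : Fin m → Bool => (∀ i, (if σ i then c i else a i) = false) ∧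
      r ≤ ((Finset.univ.filter fun i => (if σ i then a i else c i) = true).card : ℝ)
  let J := Finset.univ.filter fun i => a i = true ∨ c i = true
  rcases F.eq_empty_or_nonempty with hF | ⟨σ₀, hσ₀⟩
  · rw [hF]; simp; positivity
  have hr : r ≤ J.card := by
    refine (Finset.mem_filter.1 hσ₀).2.2.trans ?_
    refine Nat.cast_le.2 (Finset.card_le_card fun i hi => ?_)
    simp only [Finset.mem_filter, Finset.mem_univ, true_and, J] at hi ⊢
    split_ifs at hi <;> simp [hi]
  -- At a marked index, the requirement that the first half be unmarked forces the swap bit to be `a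
  -- i`; only the unmarked indices stay free.
  have hsub : F ⊆ Fintype.piFinset fun i => if i ∈ J then {a i} else Finset.univ := by
    intro σ hσ
    rw [Fintype.mem_piFinset]
    intro i
    split_ifs with hi
    · have h₁ := (Finset.mem_filter.1 hσ).2.1 i
      simp only [J, Finset.mem_filter, Finset.mem_univ, true_and] at hi
      rw [Finset.mem_singleton]
      revert h₁ hi
      cases σ i <;> cases a i <;> cases c i <;> simp
    · exact Finset.mem_univ _
  have hcard : ((Fintype.piFinset fun i => if i ∈ J then {a i} else Finset.univ).card : ℝ) =
      2 ^ m * (1 / 2) ^ J.card := by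
    rw [Fintype.card_piFinset]
    push_cast
    have : ∀ i, (((if i ∈ J then {a i} else Finset.univ : Finset Bool).card : ℕ) : ℝ) =
        2 * if i ∈ J then 1 / 2 else 1 := fun i => by split_ifs <;> simp
    simp_rw [this]
    rw [Finset.prod_mul_distrib, Finset.prod_const, Finset.prod_ite_mem]
    simp
  have hexp : (1 / 2 : ℝ) ^ J.card ≤ Real.exp (-(r / 2)) := by
    have : (1 / 2 : ℝ) ≤ Real.exp (-(1 / 2)) := by
      have := Real.add_one_le_exp (-(1 / 2) : ℝ)
      linarith
    calc (1 / 2 : ℝ) ^ J.card ≤ Real.exp (-(1 / 2)) ^ J.card := by gcongr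
      _ = Real.exp (-(J.card / 2)) := by rw [← Real.exp_nat_mul]; ring_nf
      _ ≤ _ := Real.exp_le_exp.2 (by linarith)
  calc (F.card : ℝ) ≤ ((Fintype.piFinset fun i => if i ∈ J then {a i} else Finset.univ).card : ℝ) :=
        by exact_mod_cast Finset.card_le_card hsub
    _ ≤ _ := by rw [hcard]; gcongr

end Counting

/-! ### Tail bounds and finiteness of the sample size -/

section Tails

variable {X : Type*} [MeasurableSpace X] {H : Set (X → Bool)} {d : ℕ}

theorem half_le_of_compl_le {Ω : Type*} [MeasurableSpace Ω] {P : Measure Ω} [IsProbabilityMeasure P]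
    {A B : Set Ω} (hAB : ∀ ω, ω ∉ B → ω ∈ A) {x : ℝ} (hB : P B ≤ ENNReal.ofReal x)
    (hx : x ≤ 1 / 2) : (1 / 2 : ℝ≥0∞) ≤ P A := by
  have h₁ : (1 : ℝ≥0∞) ≤ P A + P B := by
    rw [← measure_univ (μ := P)]
    refine (measure_mono fun ω _ => ?_).trans (measure_union_le A B)
    by_cases h : ω ∈ B
    · exact Or.inr h
    · exact Or.inl (hAB ω h)
  have h₂ : P B ≤ 1 / 2 := hB.trans ((ENNReal.ofReal_le_ofReal hx).trans_eq (by
    rw [ENNReal.ofReal_div_of_pos (by norm_num)]; simp))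
  have h₃ : (1 / 2 : ℝ≥0∞) + 1 / 2 ≤ P A + 1 / 2 := by
    rw [ENNReal.add_halves]
    exact h₁.trans (by gcongr)
  exact (ENNReal.add_le_add_iff_right (by simp)).1 h₃

/-- The Vapnik–Chervonenkis tail bound for uniform deviations. -/
theorem iid_uniform_deviation_le (hH : IsVCClass H d) (μ : ProbabilityMeasure X) {m : ℕ} {ε : ℝ}
    (hε : 0 < ε) (hm : 8 ≤ m * ε ^ 2) :
    iid μ m {S | ∃ h ∈ H, ε < |empRisk₀ S h - risk₀ μ h|} ≤
      ENNReal.ofReal (4 * (2 * m + 1) ^ (2 * d) * Real.exp (-(m * ε ^ 2 / 8))) := by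
  have hm0 : 0 < m := Nat.pos_of_ne_zero fun h => by norm_num [h] at hm
  have hm' : (0 : ℝ) < m := by exact_mod_cast hm0
  let c : (Fin m ⊕ Fin m → Bool) → Fin m → ℝ := fun b i =>
    (if b (.inl i) = true then 1 else 0) - if b (.inr i) = true then 1 else 0
  let P : (Fin m ⊕ Fin m → Bool) → (Fin m ⊕ Fin m → Bool) → Prop := fun b _ =>
    m * ε / 2 ≤ |∑ i, c b i|
  have h₁ : iid μ m {S | ∃ h ∈ H, ε < |empRisk₀ S h - risk₀ μ h|} ≤
      2 * iid₂ μ m (pairEvent H m P) := by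
    refine iid_le_two_mul μ m ?_
    rintro S ⟨h, hh, hS⟩
    refine half_le_of_compl_le (B := {S' | ε / 2 ≤ |empRisk₀ S' h - risk₀ μ h|}) (fun S' hS' => ?_)
      (iid_deviation_le μ (hH.measurable h hh) hm0 (half_pos hε)) ?_
    · have hS'' : |empRisk₀ S' h - risk₀ μ h| < ε / 2 := not_le.1 hS'
      refine ⟨h, hh, h, hh, ?_⟩
      have e : ∑ i, c (h ∘ Sum.elim S S') i = m * (empRisk₀ S h - empRisk₀ S' h) := by
        simp only [c, Function.comp, Sum.elim_inl, Sum.elim_inr, empRisk₀, Finset.sum_sub_distrib]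
        field_simp
        rfl
      change m * ε / 2 ≤ |∑ i, c (h ∘ Sum.elim S S') i|
      rw [e, abs_mul, abs_of_pos hm', mul_div_assoc]
      gcongr
      have := abs_sub_abs_le_abs_sub (empRisk₀ S h - risk₀ μ h) (empRisk₀ S' h - risk₀ μ h)
      rw [sub_sub_sub_cancel_right] at this
      linarith
    · have hr : risk₀ μ h ≤ 1 := measureReal_le_one
      rw [div_le_div_iff₀ (by positivity) (by norm_num)]
      nlinarith
  have h₂ : iid₂ μ m (pairEvent H m P) ≤
      ENNReal.ofReal ((2 * m + 1) ^ (2 * d) * (2 * Real.exp (-(m * ε ^ 2 / 8)))) := by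
    refine iid₂_pairEvent_le hH μ m P (by positivity) fun b b' => ?_
    have h₃ := card_abs_rademacher_le hm0 (c b) (fun i => by
      simp only [c]; split_ifs <;> norm_num) (s := m * ε / 2) (by positivity)
    have e : (m * ε / 2) ^ 2 / (2 * m) = m * ε ^ 2 / 8 := by field_simp; norm_num
    rw [e] at h₃
    refine le_trans (Nat.cast_le.2 (Finset.card_le_card fun σ hσ => ?_)) h₃
    simp only [Finset.mem_filter, Finset.mem_univ, true_and, P] at hσ ⊢
    refine hσ.trans_eq ?_
    congr 1
    refine Finset.sum_congr rfl fun i _ => ?_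
    by_cases hi : σ i = true <;> simp [c, swapPerm, hi]
  calc _ ≤ 2 * ENNReal.ofReal ((2 * m + 1) ^ (2 * d) * (2 * Real.exp (-(m * ε ^ 2 / 8)))) :=
        h₁.trans (by gcongr)
    _ = _ := by
      rw [show (2 : ℝ≥0∞) = ENNReal.ofReal 2 by simp, ← ENNReal.ofReal_mul (by norm_num)]
      ring_nf

/-- The `ε`-net tail bound for differences of members of a VC class. -/
theorem iid_missed_difference_le (hH : IsVCClass H d) (μ : ProbabilityMeasure X) {m : ℕ} {t : ℝ}
    (ht : 0 < t) (hm : 8 ≤ m * t) :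
    iid μ m {S | ∃ h ∈ H, ∃ h' ∈ H, t < (μ : Measure X).real {x | h x = false ∧ h' x = true} ∧
      ∀ i, ¬ (h (S i) = false ∧ h' (S i) = true)} ≤
      ENNReal.ofReal (2 * (2 * m + 1) ^ (2 * d) * Real.exp (-(m * t / 4))) := by
  have hm0 : 0 < m := Nat.pos_of_ne_zero fun h => by norm_num [h] at hm
  have hm' : (0 : ℝ) < m := by exact_mod_cast hm0
  let P : (Fin m ⊕ Fin m → Bool) → (Fin m ⊕ Fin m → Bool) → Prop := fun b b' =>
    (∀ i, (!b (.inl i) && b' (.inl i)) = false) ∧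
      m * t / 2 ≤ ((Finset.univ.filter fun i => (!b (.inr i) && b' (.inr i)) = true).card : ℝ)
  have h₁ : iid μ m {S | ∃ h ∈ H, ∃ h' ∈ H,
      t < (μ : Measure X).real {x | h x = false ∧ h' x = true} ∧
      ∀ i, ¬ (h (S i) = false ∧ h' (S i) = true)} ≤ 2 * iid₂ μ m (pairEvent H m P) := by
    refine iid_le_two_mul μ m ?_
    rintro S ⟨h, hh, h', hh', hp, hS⟩
    let g : X → Bool := fun x => !h x && h' x
    have hg : Measurable g := by
      have e : g = (fun p : Bool × Bool => !p.1 && p.2) ∘ fun x => (h x, h' x) := rfl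
      rw [e]
      exact (measurable_of_countable _).comp
        ((hH.measurable h hh).prodMk (hH.measurable h' hh'))
    have hpg : (μ : Measure X).real {x | h x = false ∧ h' x = true} = risk₀ μ g := by
      simp [risk₀, g]
    rw [hpg] at hp
    have hp0 : 0 < risk₀ μ g := ht.trans hp
    refine half_le_of_compl_le (B := {S' | risk₀ μ g / 2 ≤ |empRisk₀ S' g - risk₀ μ g|})
      (fun S' hS' => ?_) (iid_deviation_le μ hg hm0 (half_pos hp0)) ?_
    · have hS'' : |empRisk₀ S' g - risk₀ μ g| < risk₀ μ g / 2 := not_le.1 hS'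
      refine ⟨h, hh, h', hh', fun i => ?_, ?_⟩
      · have := hS i
        simp only [Function.comp, Sum.elim_inl]
        revert this
        cases h (S i) <;> cases h' (S i) <;> simp
      · have e : empRisk₀ S' g * m =
            ((Finset.univ.filter fun i => (!h (S' i) && h' (S' i)) = true).card : ℝ) := by
          rw [empRisk₀, div_mul_cancel₀ _ hm'.ne']
          simp [g]
        change m * t / 2 ≤
          ((Finset.univ.filter fun i => (!h (S' i) && h' (S' i)) = true).card : ℝ)
        rw [← e]
        have := (abs_lt.1 hS'').1
        nlinarith
    -- With `p` the mass of the difference set, Chebyshev at deviation `p/2` gives `4/(m p)`, at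
    -- most `1/2` because `m p ≥ m t ≥ 8`.
    · rw [div_le_div_iff₀ (by positivity) (by norm_num)]
      have : t * risk₀ μ g ≤ risk₀ μ g ^ 2 := by nlinarith
      nlinarith
  have h₂ : iid₂ μ m (pairEvent H m P) ≤
      ENNReal.ofReal ((2 * m + 1) ^ (2 * d) * Real.exp (-(m * t / 4))) := by
    refine iid₂_pairEvent_le hH μ m P (by positivity) fun b b' => ?_
    have h₃ := card_swap_le (fun i => !b (.inl i) && b' (.inl i))
      (fun i => !b (.inr i) && b' (.inr i)) (r := m * t / 2)
    rw [show m * t / 2 / 2 = m * t / 4 by ring] at h₃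
    refine le_trans (Nat.cast_le.2 (Finset.card_le_card fun σ hσ => ?_)) h₃
    simp only [Finset.mem_filter, Finset.mem_univ, true_and, P] at hσ ⊢
    refine ⟨fun i => ?_, hσ.2.trans_eq ?_⟩
    · rw [← hσ.1 i]
      by_cases hi : σ i = true <;> simp [swapPerm, hi]
    · congr 2
      ext i
      by_cases hi : σ i = true <;> simp [swapPerm, hi]
  calc _ ≤ 2 * ENNReal.ofReal ((2 * m + 1) ^ (2 * d) * Real.exp (-(m * t / 4))) :=
        h₁.trans (by gcongr)
    _ = _ := by
      rw [show (2 : ℝ≥0∞) = ENNReal.ofReal 2 by simp, ← ENNReal.ofReal_mul (by norm_num)]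
      ring_nf

/-- An infimum in `ℕ` is attained only over a nonempty set (that of the empty set is 0). A suitable
size exists because the exponential in the tail bound beats the polynomial. -/
theorem sampleSize_spec (hH : IsVCClass H d) {ε δ : ℝ} (hε : 0 < ε) (hδ : 0 < δ) :
    0 < sampleSize H ε δ ∧ ∀ μ : ProbabilityMeasure X,
      iid μ (sampleSize H ε δ) {S | ∃ h ∈ H, ε < |empRisk₀ S h - risk₀ μ h|} ≤
        ENNReal.ofReal δ := by
  refine Nat.sInf_mem (s := {m : ℕ | 0 < m ∧ ∀ μ : ProbabilityMeasure X,
    iid μ m {S | ∃ h ∈ H, ε < |empRisk₀ S h - risk₀ μ h|} ≤ ENNReal.ofReal δ}) ?_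
  have hlim : Filter.Tendsto (fun m : ℕ => 4 * (24 / ε ^ 2) ^ (2 * d) *
      (((m : ℝ) * (ε ^ 2 / 8)) ^ (2 * d) * Real.exp (-((m : ℝ) * (ε ^ 2 / 8)))))
      Filter.atTop (nhds 0) := by
    have h₁ := (Real.tendsto_pow_mul_exp_neg_atTop_nhds_zero (2 * d)).comp
      ((tendsto_natCast_atTop_atTop (R := ℝ)).atTop_mul_const (show 0 < ε ^ 2 / 8 by positivity))
    simpa using h₁.const_mul (4 * (24 / ε ^ 2) ^ (2 * d))
  have hbig := ((tendsto_natCast_atTop_atTop (R := ℝ)).atTop_mul_const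
    (show 0 < ε ^ 2 by positivity)).eventually_ge_atTop 8
  obtain ⟨m, h₁, h₂, h₃⟩ := ((hlim.eventually_lt_const hδ).and
    (hbig.and (Filter.eventually_gt_atTop 0))).exists
  refine ⟨m, h₃, fun μ => (iid_uniform_deviation_le hH μ hε h₂).trans
    (ENNReal.ofReal_le_ofReal (le_trans ?_ h₁.le))⟩
  have hm1 : (1 : ℝ) ≤ m := by exact_mod_cast h₃
  have e : (2 * (m : ℝ) + 1) ≤ (24 / ε ^ 2) * (m * (ε ^ 2 / 8)) := by
    have : (24 / ε ^ 2) * (m * (ε ^ 2 / 8)) = 3 * m := by field_simp; norm_num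
    linarith
  calc 4 * (2 * (m : ℝ) + 1) ^ (2 * d) * Real.exp (-(m * ε ^ 2 / 8))
      ≤ 4 * ((24 / ε ^ 2) * (m * (ε ^ 2 / 8))) ^ (2 * d) * Real.exp (-(m * ε ^ 2 / 8)) := by gcongr
    _ = _ := by rw [mul_pow, mul_div_assoc]; ring

end Tails

/-! ### Empirical level sets and empirical risk minimization -/

section Empirical

variable {X : Type*} {H : Set (X → Bool)} {d : ℕ}

theorem HasVCDim.nonempty (hd : HasVCDim H d) : H.Nonempty := by
  obtain ⟨s, _, hs⟩ := hd.1
  obtain ⟨h, hh, _⟩ := hs fun _ => false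
  exact ⟨h, hh⟩

/-- The hypotheses of empirical `μ₀`-risk at most `β`. -/
def empLevel (H : Set (X → Bool)) (β : ℝ) {m : ℕ} (S : Fin m → X) : Set (X → Bool) :=
  {h ∈ H | empRisk₀ S h ≤ β}

/-- The empirical risk minimizer over the empirical level set, as a learner. -/
theorem exists_erm (hH : H.Nonempty) (β : ℝ) (m n : ℕ) :
    ∃ hhat : (Fin m → X) × (Fin n → X) → H, ∀ S, (empLevel H β S.1).Nonempty →
      (hhat S : X → Bool) ∈ empLevel H β S.1 ∧ ∀ h ∈ empLevel H β S.1,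
        (Finset.univ.filter fun i => (hhat S : X → Bool) (S.2 i) = false).card ≤
          (Finset.univ.filter fun i => h (S.2 i) = false).card := by
  obtain ⟨h₀, hh₀⟩ := hH
  refine ⟨_, fun S => Classical.choose_spec (p := fun g : H => (empLevel H β S.1).Nonempty →
      (g : X → Bool) ∈ empLevel H β S.1 ∧ ∀ h ∈ empLevel H β S.1,
        (Finset.univ.filter fun i => (g : X → Bool) (S.2 i) = false).card ≤
          (Finset.univ.filter fun i => h (S.2 i) = false).card) ?_⟩
  by_cases hne : (empLevel H β S.1).Nonempty
  · obtain ⟨g, hg, hmin⟩ := exists_minimalFor_of_wellFoundedLT (· ∈ empLevel H β S.1)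
      (fun h => (Finset.univ.filter fun i => h (S.2 i) = false).card) hne
    exact ⟨⟨g, hg.1⟩, fun _ => ⟨hg, fun h hh => (le_total _ _).elim id fun hle => hmin hh hle⟩⟩
  · exact ⟨⟨h₀, hh₀⟩, fun h => absurd h hne⟩

theorem card_false_eq {m : ℕ} (hm : 0 < m) (S : Fin m → X) (h : X → Bool) :
    ((Finset.univ.filter fun i => h (S i) = false).card : ℝ) = m * (1 - empRisk₀ S h) := by
  have hm' : (0 : ℝ) < m := by exact_mod_cast hm
  have e := Finset.card_filter_add_card_filter_not (s := (Finset.univ : Finset (Fin m)))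
    fun i => h (S i) = true
  have e' : (Finset.univ.filter fun i => ¬ h (S i) = true) =
      Finset.univ.filter fun i => h (S i) = false := by ext i; simp
  rw [e', Finset.card_univ, Fintype.card_fin] at e
  have e'' : ((Finset.univ.filter fun i => h (S i) = true).card : ℝ) +
    (Finset.univ.filter fun i => h (S i) = false).card = m := by exact_mod_cast e
  rw [empRisk₀, mul_sub, mul_div_cancel₀ _ hm'.ne', mul_one, Finset.sum_boole]
  linarith

theorem half_le_log {d n : ℕ} (hd : 1 ≤ d) (hn : 2 * d ≤ n) : (1 / 2 : ℝ) ≤ Real.log n := by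
  have h2 : (2 : ℝ) ≤ n := by exact_mod_cast (by omega : 2 ≤ n)
  have := Real.log_le_log (by norm_num) h2
  linarith [Real.log_two_gt_d9]

/-- Here `4 ≤ n^{2d}` and `2n+1 ≤ n³`, so the prefactor is at most `n^{8d}`; the exponent 9 leaves
`n^{-d} ≤ 1/n`. -/
theorem tail_le {d n : ℕ} (hd : 1 ≤ d) (hn : 2 * d ≤ n) {K : ℝ}
    (hK : 9 * (d * Real.log n) ≤ K) :
    4 * (2 * (n : ℝ) + 1) ^ (2 * d) * Real.exp (-K) ≤ 1 / n := by
  have hn2 : 2 ≤ n := by omega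
  have h2 : (2 : ℝ) ≤ n := by exact_mod_cast hn2
  have hn0 : (0 : ℝ) < n := by linarith
  have h₁ : 2 * (n : ℝ) + 1 ≤ n ^ 3 := by nlinarith [mul_nonneg hn0.le hn0.le]
  have h₂ : (4 : ℝ) ≤ (n : ℝ) ^ (2 * d) := by
    calc (4 : ℝ) ≤ (n : ℝ) ^ 2 := by nlinarith
      _ ≤ _ := pow_le_pow_right₀ (by linarith) (by omega)
  have h₃ : Real.exp (-K) ≤ 1 / (n : ℝ) ^ (9 * d) := by
    rw [Real.exp_neg, ← one_div]
    refine one_div_le_one_div_of_le (by positivity) ?_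
    calc (n : ℝ) ^ (9 * d) = Real.exp (9 * (d * Real.log n)) := by
          rw [← Real.exp_log (by positivity : (0 : ℝ) < (n : ℝ) ^ (9 * d)), Real.log_pow]
          push_cast; ring_nf
      _ ≤ _ := Real.exp_le_exp.2 hK
  calc 4 * (2 * (n : ℝ) + 1) ^ (2 * d) * Real.exp (-K)
      ≤ (n : ℝ) ^ (2 * d) * ((n : ℝ) ^ 3) ^ (2 * d) * (1 / (n : ℝ) ^ (9 * d)) := by gcongr
    _ = 1 / (n : ℝ) ^ d := by
      rw [← pow_mul, ← pow_add, mul_one_div, div_eq_div_iff (by positivity) (by positivity),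
        ← pow_add, one_mul]
      congr 1; ring
    _ ≤ 1 / n := by
      refine one_div_le_one_div_of_le hn0 ?_
      exact le_self_pow₀ (by linarith) (by omega)

end Empirical

/-! ### Upper bounds on the minimax risk -/

section Upper

variable {X : Type*} [MeasurableSpace X] {H : Set (X → Bool)} {d : ℕ}

theorem risk₁_eq (μ : ProbabilityMeasure X) {h : X → Bool} (hh : Measurable h) :
    risk₁ μ h = 1 - risk₀ μ h := by
  have hset : MeasurableSet {x | h x = true} := hh (measurableSet_singleton true)
  have e : {x | h x = false} = {x | h x = true}ᶜ := by ext x; simp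
  rw [risk₁, e, probReal_compl_eq_one_sub hset, risk₀]

theorem risk₁_nonneg (μ : ProbabilityMeasure X) (h : X → Bool) : 0 ≤ risk₁ μ h := measureReal_nonneg

theorem risk₁_le_one (μ : ProbabilityMeasure X) (h : X → Bool) : risk₁ μ h ≤ 1 := measureReal_le_one

theorem excessRisk_le {α t : ℝ} (ht : 0 ≤ t) {μ₀ μ₁ : ProbabilityMeasure X}
    (hne : (level H α μ₀).Nonempty) {g : X → Bool}
    (hg : ∀ h ∈ level H α μ₀, risk₁ μ₁ g ≤ risk₁ μ₁ h + t) : excessRisk H α μ₀ μ₁ g ≤ t := by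
  refine max_le ht ?_
  have : risk₁ μ₁ g - t ≤ sInf (risk₁ μ₁ '' level H α μ₀) := by
    refine le_csInf (hne.image _) ?_
    rintro _ ⟨h, hh, rfl⟩
    linarith [hg h hh]
  linarith

theorem excessRisk_le_one {α : ℝ} {μ₀ μ₁ : ProbabilityMeasure X} (g : X → Bool) :
    excessRisk H α μ₀ μ₁ g ≤ 1 := by
  refine max_le zero_le_one ?_
  have : 0 ≤ sInf (risk₁ μ₁ '' level H α μ₀) := by
    refine Real.sInf_nonneg ?_
    rintro _ ⟨h, _, rfl⟩
    exact risk₁_nonneg _ _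
  linarith [risk₁_le_one μ₁ g]

theorem sub_le_excessRisk {α : ℝ} {μ₀ μ₁ : ProbabilityMeasure X} (g : X → Bool) {h : X → Bool}
    (hh : h ∈ level H α μ₀) : risk₁ μ₁ g - risk₁ μ₁ h ≤ excessRisk H α μ₀ μ₁ g := by
  refine le_trans ?_ (le_max_right _ _)
  have : sInf (risk₁ μ₁ '' level H α μ₀) ≤ risk₁ μ₁ h :=
    csInf_le ⟨0, by rintro _ ⟨h, _, rfl⟩; exact risk₁_nonneg _ _⟩ ⟨h, hh, rfl⟩
  linarith

/-- The samples on which some empirical risk deviates by more than `ε` from the true risk. -/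
def deviationEvent (H : Set (X → Bool)) (ε : ℝ) (μ : ProbabilityMeasure X) (m : ℕ) :
    Set (Fin m → X) :=
  {S | ∃ h ∈ H, ε < |empRisk₀ S h - risk₀ μ h|}

theorem level_subset_empLevel {α ε : ℝ} {μ : ProbabilityMeasure X} {m : ℕ} {S : Fin m → X}
    (hS : S ∉ deviationEvent H ε μ m) : level H α μ ⊆ empLevel H (α + ε) S := fun h hh => by
  have : |empRisk₀ S h - risk₀ μ h| ≤ ε := not_lt.1 fun hlt => hS ⟨h, hh.1, hlt⟩
  exact ⟨hh.1, by linarith [(abs_le.1 this).2, hh.2]⟩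

theorem empLevel_subset_level {β ε : ℝ} {μ : ProbabilityMeasure X} {m : ℕ} {S : Fin m → X}
    (hS : S ∉ deviationEvent H ε μ m) : empLevel H β S ⊆ level H (β + ε) μ := fun h hh => by
  have : |empRisk₀ S h - risk₀ μ h| ≤ ε := not_lt.1 fun hlt => hS ⟨h, hh.1, hlt⟩
  exact ⟨hh.1, by linarith [(abs_le.1 this).1, hh.2]⟩

instance (μ₀ μ₁ : ProbabilityMeasure X) (m n : ℕ) : IsProbabilityMeasure (samples μ₀ μ₁ m n) := by
  unfold samples; infer_instance

theorem samples_fst_preimage (μ₀ μ₁ : ProbabilityMeasure X) (m n : ℕ) (B : Set (Fin m → X)) :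
    samples μ₀ μ₁ m n {S | S.1 ∈ B} = iid μ₀ m B := by
  have e : {S : (Fin m → X) × (Fin n → X) | S.1 ∈ B} = B ×ˢ Set.univ := by ext; simp
  rw [e, samples, Measure.prod_prod, measure_univ, mul_one]

theorem samples_snd_preimage (μ₀ μ₁ : ProbabilityMeasure X) (m n : ℕ) (B : Set (Fin n → X)) :
    samples μ₀ μ₁ m n {S | S.2 ∈ B} = iid μ₁ n B := by
  have e : {S : (Fin m → X) × (Fin n → X) | S.2 ∈ B} = Set.univ ×ˢ B := by ext; simp
  rw [e, samples, Measure.prod_prod, measure_univ, one_mul]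

/-- A learner that returns an element of the empirical level set is an approximate learner. -/
theorem mem_approxLearners_of_empLevel (hH : IsVCClass H d) {α ε₀ δ₀ : ℝ} (hε₀ : 0 < ε₀)
    (hδ₀ : 0 < δ₀) {n : ℕ}
    {hhat : (Fin (sampleSize H (ε₀ / 2) δ₀) → X) × (Fin n → X) → H}
    (hhat_mem : ∀ S, (empLevel H (α + ε₀ / 2) S.1).Nonempty →
      (hhat S : X → Bool) ∈ empLevel H (α + ε₀ / 2) S.1) :
    hhat ∈ approxLearners H α ε₀ δ₀ (sampleSize H (ε₀ / 2) δ₀) n := by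
  intro p hp
  have hdev := (sampleSize_spec hH (half_pos hε₀) hδ₀).2 p.1
  refine le_trans (measure_mono fun S hS => ?_) ((samples_fst_preimage p.1 p.2 _ n
    (deviationEvent H (ε₀ / 2) p.1 _)).trans_le hdev)
  by_contra hcon
  have hmem := empLevel_subset_level hcon
    (hhat_mem S (Set.Nonempty.mono (level_subset_empLevel hcon) hp))
  rw [add_assoc, add_halves] at hmem
  exact hS hmem

/-- The excess risk is at most 1, so `t` plus the indicators of measurable hulls of the two bad
events is a measurable majorant, whatever the learner. -/
theorem outerExp_le {α t q δ₀ β : ℝ} (ht : 0 ≤ t) (hq : 0 ≤ q) (hδ₀ : 0 ≤ δ₀) {m n : ℕ}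
    {μ₀ μ₁ : ProbabilityMeasure X} {hhat : (Fin m → X) × (Fin n → X) → H}
    {B₀ : Set (Fin m → X)} {B₁ : Set (Fin n → X)} (hB₀ : iid μ₀ m B₀ ≤ ENNReal.ofReal δ₀)
    (hB₁ : iid μ₁ n B₁ ≤ ENNReal.ofReal q)
    (hgood : ∀ S, S.1 ∉ B₀ → S.2 ∉ B₁ → excessRisk H α μ₀ μ₁ (hhat S) ≤ t) :
    outerExp (samples μ₀ μ₁ m n)
      (Set.indicator {S | (hhat S : X → Bool) ∈ level H β μ₀}
        fun S => ENNReal.ofReal (excessRisk H α μ₀ μ₁ (hhat S))) ≤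
      ENNReal.ofReal (t + q + δ₀) := by
  set P := samples μ₀ μ₁ m n
  set A := {S : (Fin m → X) × (Fin n → X) | S.1 ∈ B₀}
  set A' := {S : (Fin m → X) × (Fin n → X) | S.2 ∈ B₁}
  have hA : P A ≤ ENNReal.ofReal δ₀ := (samples_fst_preimage μ₀ μ₁ m n B₀).trans_le hB₀
  have hA' : P A' ≤ ENNReal.ofReal q := (samples_snd_preimage μ₀ μ₁ m n B₁).trans_le hB₁
  have h1 : ∀ B, Measurable fun S =>
      (toMeasurable P B).indicator (1 : (Fin m → X) × (Fin n → X) → ℝ≥0∞) S := fun B =>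
    measurable_one.indicator (measurableSet_toMeasurable _ _)
  have hm : Measurable fun S => ENNReal.ofReal t + (toMeasurable P A').indicator 1 S +
      (toMeasurable P A).indicator (1 : (Fin m → X) × (Fin n → X) → ℝ≥0∞) S :=
    (measurable_const.add (h1 A')).add (h1 A)
  refine (iInf₂_le _ hm).trans ((iInf_le _ fun S => ?_).trans ?_)
  · refine (Set.indicator_le_self _ _ S).trans ?_
    beta_reduce
    by_cases h₀ : S ∈ A
    · have : (toMeasurable P A).indicator (1 : (Fin m → X) × (Fin n → X) → ℝ≥0∞) S = 1 := by
        simp [subset_toMeasurable P A h₀]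
      rw [this]
      exact le_trans (ENNReal.ofReal_le_one.2 (excessRisk_le_one _)) le_add_self
    by_cases h₁ : S ∈ A'
    · have : (toMeasurable P A').indicator (1 : (Fin m → X) × (Fin n → X) → ℝ≥0∞) S = 1 := by
        simp [subset_toMeasurable P A' h₁]
      rw [this]
      exact (ENNReal.ofReal_le_one.2 (excessRisk_le_one _)).trans
        (le_add_self.trans le_self_add)
    · exact (ENNReal.ofReal_le_ofReal (hgood S h₀ h₁)).trans (le_self_add.trans le_self_add)
  · rw [lintegral_add_right _ (h1 A), lintegral_add_right _ (h1 A'),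
      lintegral_indicator_one (measurableSet_toMeasurable _ _),
      lintegral_indicator_one (measurableSet_toMeasurable _ _), lintegral_const, measure_univ,
      mul_one, measure_toMeasurable, measure_toMeasurable,
      ENNReal.ofReal_add (by positivity) hδ₀, ENNReal.ofReal_add ht hq]
    gcongr

theorem minimaxRisk_le_of_learner {α ε₀ δ₀ : ℝ} {m n : ℕ} {r : ℝ≥0∞}
    {hhat : (Fin m → X) × (Fin n → X) → H} (hmem : hhat ∈ approxLearners H α ε₀ δ₀ m n)
    (h : ∀ p ∈ pairs H α, outerExp (samples p.1 p.2 m n)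
      (Set.indicator {S | (hhat S : X → Bool) ∈ level H (α + ε₀) p.1}
        fun S => ENNReal.ofReal (excessRisk H α p.1 p.2 (hhat S))) ≤ r) :
    minimaxRisk H α ε₀ δ₀ m n ≤ r :=
  (iInf₂_le hhat hmem).trans (iSup₂_le h)

/-- The upper bound of order `√(d log n / n)`. -/
theorem minimaxRisk_le_sqrt (hH : IsVCClass H d) {α ε₀ δ₀ : ℝ} (hε₀ : 0 < ε₀) (hδ₀ : 0 < δ₀)
    {n : ℕ} (hd : 1 ≤ d) (hn : 2 * d ≤ n) :
    minimaxRisk H α ε₀ δ₀ (sampleSize H (ε₀ / 2) δ₀) n ≤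
      ENNReal.ofReal (40 * √(d / n * Real.log n) + δ₀) := by
  have hlog := half_le_log hd hn
  have hn0 : 0 < n := by omega
  have hn' : (0 : ℝ) < n := by exact_mod_cast hn0
  have hd' : (1 : ℝ) ≤ d := by exact_mod_cast hd
  set R := √(d / n * Real.log n) with hR
  have hx : 0 < d / n * Real.log n := by positivity
  have hR0 : 0 < R := Real.sqrt_pos.2 hx
  have hR2 : R ^ 2 = d / n * Real.log n := Real.sq_sqrt hx.le
  have hnR : n * R ^ 2 = d * Real.log n := by rw [hR2]; field_simp
  have hdlog : 1 / 2 ≤ d * Real.log n := by nlinarith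
  obtain ⟨hhat, hhat_spec⟩ := exists_erm hH.hasVCDim.nonempty (α + ε₀ / 2)
    (sampleSize H (ε₀ / 2) δ₀) n
  have hmem := mem_approxLearners_of_empLevel hH hε₀ hδ₀ fun S hS => (hhat_spec S hS).1
  refine minimaxRisk_le_of_learner hmem fun p hp => ?_
  have hB₀ := (sampleSize_spec hH (half_pos hε₀) hδ₀).2 p.1
  -- The factor 9 makes the exponent `81/8 · d log n`, above the `9 d log n` that `tail_le`
  -- requires.
  have hB₁ := iid_uniform_deviation_le hH p.2 (m := n) (ε := 9 * R) (by positivity)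
    (by rw [mul_pow, mul_left_comm, hnR]; linarith)
  refine (outerExp_le (t := 18 * R) (by positivity) (by positivity) hδ₀.le hB₀ hB₁
    fun S h₀ h₁ => ?_).trans (ENNReal.ofReal_le_ofReal ?_)
  · have hsub : level H α p.1 ⊆ empLevel H (α + ε₀ / 2) S.1 := level_subset_empLevel h₀
    refine excessRisk_le (by positivity) hp fun h hh => ?_
    obtain ⟨hg, hmin⟩ := hhat_spec S (hp.mono hsub)
    have hle : ((Finset.univ.filter fun i => (hhat S : X → Bool) (S.2 i) = false).card : ℝ) ≤
      ((Finset.univ.filter fun i => h (S.2 i) = false).card : ℝ) :=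
      Nat.cast_le.2 (hmin h (hsub hh))
    rw [card_false_eq hn0, card_false_eq hn0] at hle
    have hle' := le_of_mul_le_mul_left hle hn'
    have d₁ : |empRisk₀ S.2 h - risk₀ p.2 h| ≤ 9 * R := not_lt.1 fun hlt => h₁ ⟨h, hh.1, hlt⟩
    have d₂ : |empRisk₀ S.2 (hhat S) - risk₀ p.2 (hhat S)| ≤ 9 * R :=
      not_lt.1 fun hlt => h₁ ⟨_, hg.1, hlt⟩
    rw [risk₁_eq _ (hH.measurable _ hg.1), risk₁_eq _ (hH.measurable _ hh.1)]
    linarith [(abs_le.1 d₁).1, (abs_le.1 d₂).2]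
  · have htail := tail_le hd hn (K := n * (9 * R) ^ 2 / 8) (by
      have : n * (9 * R) ^ 2 / 8 = 81 / 8 * (n * R ^ 2) := by ring
      rw [this, hnR]; linarith)
    have h₂ : 1 / (n : ℝ) ≤ 2 * R := by
      have h1n : (1 : ℝ) ≤ n := by exact_mod_cast hn0
      refine le_of_sq_le_sq ?_ (by positivity)
      rw [mul_pow, hR2]
      rw [div_pow, one_pow, div_le_iff₀ (by positivity)]
      have : 2 ^ 2 * (d / n * Real.log n) * (n : ℝ) ^ 2 = 4 * (d * Real.log n) * n := by
        field_simp; norm_num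
      rw [this]
      nlinarith
    linarith

/-- The upper bound of order `d log n / n` for classes that do not separate three points. -/
theorem minimaxRisk_le_div (hH : IsVCClass H d) (hsep : ¬ SeparatesThreePoints H) {α ε₀ δ₀ : ℝ}
    (hε₀ : 0 < ε₀) (hα : α + ε₀ < 1 / 2) (hδ₀ : 0 < δ₀)
    {n : ℕ} (hd : 1 ≤ d) (hn : 2 * d ≤ n) :
    minimaxRisk H α ε₀ δ₀ (sampleSize H (ε₀ / 2) δ₀) n ≤
      ENNReal.ofReal (40 * (d / n * Real.log n) + δ₀) := by
  have hlog := half_le_log hd hn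
  have hn0 : 0 < n := by omega
  have hn' : (0 : ℝ) < n := by exact_mod_cast hn0
  have hd' : (1 : ℝ) ≤ d := by exact_mod_cast hd
  set R := d / n * Real.log n with hR
  have hR0 : 0 < R := by positivity
  have hnR : n * R = d * Real.log n := by rw [hR]; field_simp
  have hdlog : 1 / 2 ≤ d * Real.log n := by nlinarith
  obtain ⟨hhat, hhat_spec⟩ := exists_erm hH.hasVCDim.nonempty (α + ε₀ / 2)
    (sampleSize H (ε₀ / 2) δ₀) n
  have hmem := mem_approxLearners_of_empLevel hH hε₀ hδ₀ fun S hS => (hhat_spec S hS).1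
  refine minimaxRisk_le_of_learner hmem fun p hp => ?_
  have hB₀ := (sampleSize_spec hH (half_pos hε₀) hδ₀).2 p.1
  have hB₁ := iid_missed_difference_le hH p.2 (m := n) (t := 36 * R) (by positivity)
    (by rw [mul_left_comm, hnR]; linarith)
  refine (outerExp_le (t := 36 * R) (by positivity) (by positivity) hδ₀.le hB₀ hB₁
    fun S h₀ h₁ => ?_).trans (ENNReal.ofReal_le_ofReal ?_)
  · have hsub : level H α p.1 ⊆ empLevel H (α + ε₀ / 2) S.1 := level_subset_empLevel h₀
    have hsub' := empLevel_subset_level (β := α + ε₀ / 2) h₀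
    rw [add_assoc, add_halves] at hsub'
    refine excessRisk_le (by positivity) hp fun h hh => ?_
    obtain ⟨hg, hmin⟩ := hhat_spec S (hp.mono hsub)
    -- If the learner's zero set is the smaller one, there is no loss. Otherwise minimality makes
    -- both zero sets agree on the second sample, which therefore misses the difference.
    rcases level_nested hsep hα (hsub' hg) (hsub' (hsub hh)) with hle | hle
    · have : risk₁ p.2 (hhat S) ≤ risk₁ p.2 h :=
        measureReal_mono fun x hx => hle x hx
      linarith
    · have hcover : {x | (hhat S : X → Bool) x = false} ⊆
          {x | h x = false} ∪ {x | (hhat S : X → Bool) x = false ∧ h x = true} := fun x hx => by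
        by_cases hx' : h x = false
        · exact Or.inl hx'
        · exact Or.inr ⟨hx, by simpa using hx'⟩
      have h₂ := (measureReal_mono (μ := (p.2 : Measure X)) hcover).trans
        (measureReal_union_le _ _)
      have heq := Finset.eq_of_subset_of_card_le
        (Finset.monotone_filter_right Finset.univ fun i _ hi => hle (S.2 i) hi) (hmin h (hsub hh))
      have h₃ : (p.2 : Measure X).real {x | (hhat S : X → Bool) x = false ∧ h x = true} ≤ 36 * R :=
        not_lt.1 fun hlt => h₁ ⟨_, hg.1, h, hh.1, hlt, fun i hi => by
          have := Finset.ext_iff.1 heq i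
          simp [hi.1, hi.2] at this⟩
      simp only [risk₁]
      linarith
  · have htail := tail_le hd hn (K := n * (36 * R) / 4) (by
      have : n * (36 * R) / 4 = 9 * (n * R) := by ring
      rw [this, hnR])
    have h₂ : 1 / (n : ℝ) ≤ 2 * R := by
      rw [div_le_iff₀ hn', mul_assoc, mul_comm R, hnR]
      linarith
    have h₃ : 0 ≤ (2 * (n : ℝ) + 1) ^ (2 * d) * Real.exp (-(n * (36 * R) / 4)) := by positivity
    linarith

end Upper

/-! ### A learner without excess risk -/

section ZeroError

variable {X : Type*} [MeasurableSpace X] [MeasurableSingletonClass X] {H : Set (X → Bool)} {d : ℕ}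

theorem exists_empirical_measure {m : ℕ} (hm : 0 < m) (S : Fin m → X) :
    ∃ μ : ProbabilityMeasure X, FinitelySupported μ ∧ ∀ h, risk₀ μ h = empRisk₀ S h := by
  have hm' : (m : ℝ) ≠ 0 := by exact_mod_cast hm.ne'
  refine ⟨discrete (fun _ : Fin m => 1 / m) (fun _ => by positivity) (by simp [hm']) S,
    finitelySupported_discrete, fun h => ?_⟩
  rw [risk₀_discrete, empRisk₀, Finset.sum_div]
  exact Finset.sum_congr rfl fun i _ => by split_ifs <;> simp

/-- If all level sets of finitely supported distributions admit maximal elements, then some learner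
has no excess risk, with high probability. -/
theorem exists_learner_excessRisk_eq_zero (hH : IsVCClass H d) (hsep : ¬ SeparatesThreePoints H)
    {α ε₀ δ₀ : ℝ} (hα : 0 < α) (hε₀ : 0 < ε₀) (hαε : α + ε₀ < 1 / 2) (hδ₀ : 0 < δ₀) (n : ℕ)
    (hmax : ∀ μ₀ : ProbabilityMeasure X, FinitelySupported μ₀ →
      (level H (α + ε₀) μ₀).Nonempty → AdmitsMaximal (level H (α + ε₀) μ₀)) :
    ∃ hhat ∈ approxLearners H α ε₀ δ₀ (sampleSize H (ε₀ / 2) δ₀) n, ∀ p ∈ pairs H α,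
      samples p.1 p.2 (sampleSize H (ε₀ / 2) δ₀) n
        {S | ¬ ((hhat S : X → Bool) ∈ level H (α + ε₀) p.1 ∧
          excessRisk H α p.1 p.2 (hhat S) = 0)} ≤ ENNReal.ofReal δ₀ := by
  obtain ⟨hpos, hdev⟩ := sampleSize_spec hH (half_pos hε₀) hδ₀
  set m := sampleSize H (ε₀ / 2) δ₀
  have hmaxEmp : ∀ S : Fin m → X, (empLevel H (α + ε₀ / 2) S).Nonempty →
      AdmitsMaximal (empLevel H (α + ε₀ / 2) S) := by
    intro S hS
    obtain ⟨μ, hμ, hrisk⟩ := exists_empirical_measure hpos S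
    have e : empLevel H (α + ε₀ / 2) S = level H (α + ε₀ / 2) μ := by
      ext h; simp [empLevel, level, hrisk]
    rw [e] at hS ⊢
    -- The empirical set has level `α + ε₀/2`, whereas maximal elements are granted at `α + ε₀`;
    -- passing to `twoPoint t s` bridges the two levels.
    obtain ⟨t, s, hts⟩ := exists_level_eq hsep (by linarith) hμ hS
    rw [hts, ← level_twoPoint (by positivity : 0 ≤ α + ε₀) hαε t s] at hS ⊢
    exact hmax _ finitelySupported_discrete hS
  have hchoice : ∀ S : (Fin m → X) × (Fin n → X), ∃ g : H,
      (empLevel H (α + ε₀ / 2) S.1).Nonempty → (g : X → Bool) ∈ empLevel H (α + ε₀ / 2) S.1 ∧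
        ∀ h ∈ empLevel H (α + ε₀ / 2) S.1, {x | h x = true} ⊆ {x | (g : X → Bool) x = true} := by
    intro S
    by_cases hS : (empLevel H (α + ε₀ / 2) S.1).Nonempty
    · obtain ⟨g, hg, hle⟩ := hmaxEmp S.1 hS
      exact ⟨⟨g, hg.1⟩, fun _ => ⟨hg, hle⟩⟩
    · obtain ⟨h, hh⟩ := hH.hasVCDim.nonempty
      exact ⟨⟨h, hh⟩, fun h => absurd h hS⟩
  choose hhat hhat_spec using hchoice
  refine ⟨hhat, mem_approxLearners_of_empLevel hH hε₀ hδ₀ fun S hS => (hhat_spec S hS).1,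
    fun p hp => ?_⟩
  refine le_trans (measure_mono fun S hS => ?_) ((samples_fst_preimage p.1 p.2 _ n
    (deviationEvent H (ε₀ / 2) p.1 _)).trans_le (hdev p.1))
  by_contra hcon
  have hsub := level_subset_empLevel (α := α) hcon
  obtain ⟨hg, hle⟩ := hhat_spec S (hp.mono hsub)
  have hmem := empLevel_subset_level hcon hg
  rw [add_assoc, add_halves] at hmem
  refine hS ⟨hmem, le_antisymm (excessRisk_le le_rfl hp fun h hh => ?_) (le_max_left _ _)⟩
  rw [add_zero]
  refine measureReal_mono fun x hx => ?_
  by_contra hx'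
  have : x ∈ {x | (hhat S : X → Bool) x = true} := hle h (hsub hh) (by simpa using hx')
  exact absurd this (by simpa using hx)

end ZeroError

/-! ### Samples from finitely many atoms -/

section Atoms

/-- A measurable majorant of `F` dominates it at each atom, so non-measurable learners are covered
by the lower bounds. -/
theorem sum_le_outerExp {Ω A : Type*} [MeasurableSpace Ω] [MeasurableSingletonClass Ω] [Fintype A]
    {P : Measure Ω} {e : A → Ω} (he : e.Injective) (F : Ω → ℝ≥0∞) :
    ∑ s, P {e s} * F (e s) ≤ outerExp P F := by
  classical
  refine le_iInf₂ fun g hg => le_iInf fun hFg => ?_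
  calc ∑ s, P {e s} * F (e s) ≤ ∑ s, P {e s} * g (e s) := by gcongr; exact hFg _
    _ = ∑ ω ∈ Finset.univ.image e, g ω * P {ω} := by
      rw [Finset.sum_image fun _ _ _ _ h => he h]
      exact Finset.sum_congr rfl fun _ _ => mul_comm _ _
    _ = ∫⁻ ω in (Finset.univ.image e : Finset Ω), g ω ∂P := (lintegral_finset _ _).symm
    _ ≤ _ := setLIntegral_le_lintegral _ _

open Classical in
theorem sum_weight_le_of_measure_le {Ω A : Type*} [MeasurableSpace Ω] [MeasurableSingletonClass Ω]
    [Fintype A] {P : Measure Ω} {e : A → Ω} (he : e.Injective) {W : A → ℝ} (hW : ∀ s, 0 ≤ W s)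
    (hP : ∀ s, P {e s} = ENNReal.ofReal (W s)) {B : Set Ω} {δ : ℝ} (hδ : 0 ≤ δ)
    (hB : P B ≤ ENNReal.ofReal δ) : ∑ s, (if e s ∈ B then W s else 0) ≤ δ := by
  have h₁ : P (((Finset.univ.filter fun s => e s ∈ B).image e : Finset Ω) : Set Ω) ≤ P B := by
    refine measure_mono fun ω hω => ?_
    obtain ⟨s, hs, rfl⟩ := Finset.mem_image.1 (Finset.mem_coe.1 hω)
    exact (Finset.mem_filter.1 hs).2
  rw [← sum_measure_singleton, Finset.sum_image fun _ _ _ _ h => he h] at h₁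
  simp only [hP] at h₁
  rw [← ENNReal.ofReal_sum_of_nonneg fun s _ => hW s, Finset.sum_filter] at h₁
  exact (ENNReal.ofReal_le_ofReal_iff hδ).1 (h₁.trans hB)

variable {X ι : Type*}

/-- The weight of a pair of samples of atoms. -/
def sampleWeight (w₀ w₁ : ι → ℝ) {m n : ℕ} (s : (Fin m → ι) × (Fin n → ι)) : ℝ :=
  (∏ i, w₀ (s.1 i)) * ∏ i, w₁ (s.2 i)

theorem sampleWeight_nonneg {w₀ w₁ : ι → ℝ} (h₀ : ∀ i, 0 ≤ w₀ i) (h₁ : ∀ i, 0 ≤ w₁ i) {m n : ℕ}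
    (s : (Fin m → ι) × (Fin n → ι)) : 0 ≤ sampleWeight w₀ w₁ s :=
  mul_nonneg (Finset.prod_nonneg fun _ _ => h₀ _) (Finset.prod_nonneg fun _ _ => h₁ _)

theorem sqrt_sampleWeight_mul {w₀ w₁ w₀' w₁' : ι → ℝ} (h₀ : ∀ i, 0 ≤ w₀ i) (h₁ : ∀ i, 0 ≤ w₁ i)
    (h₀' : ∀ i, 0 ≤ w₀' i) (h₁' : ∀ i, 0 ≤ w₁' i) {m n : ℕ} (s : (Fin m → ι) × (Fin n → ι)) :
    √(sampleWeight w₀ w₁ s * sampleWeight w₀' w₁' s) =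
      sampleWeight (fun i => √(w₀ i * w₀' i)) (fun i => √(w₁ i * w₁' i)) s := by
  simp only [sampleWeight]
  rw [mul_mul_mul_comm, ← Finset.prod_mul_distrib, ← Finset.prod_mul_distrib,
    Real.sqrt_mul (Finset.prod_nonneg fun _ _ => mul_nonneg (h₀ _) (h₀' _)),
    Real.sqrt_prod _ fun i _ => mul_nonneg (h₀ _) (h₀' _),
    Real.sqrt_prod _ fun i _ => mul_nonneg (h₁ _) (h₁' _)]

/-- A pair of samples of atoms, as a pair of samples of points. -/
def samplePoints (pt : ι → X) {m n : ℕ} (s : (Fin m → ι) × (Fin n → ι)) :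
    (Fin m → X) × (Fin n → X) :=
  (pt ∘ s.1, pt ∘ s.2)

theorem samplePoints_injective {pt : ι → X} (hpt : pt.Injective) (m n : ℕ) :
    Function.Injective (samplePoints pt : (Fin m → ι) × (Fin n → ι) → _) := fun _ _ h =>
  Prod.ext (hpt.comp_left (Prod.ext_iff.1 h).1) (hpt.comp_left (Prod.ext_iff.1 h).2)

theorem sum_sampleWeight [Fintype ι] (w₀ w₁ : ι → ℝ) (m n : ℕ) :
    ∑ s : (Fin m → ι) × (Fin n → ι), sampleWeight w₀ w₁ s = (∑ i, w₀ i) ^ m * (∑ i, w₁ i) ^ n := by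
  rw [Fintype.sum_pow, Fintype.sum_pow, Finset.sum_mul_sum, Fintype.sum_prod_type]
  rfl

variable [MeasurableSpace X] [MeasurableSingletonClass X] [Fintype ι]

theorem samples_samplePoints {w₀ w₁ : ι → ℝ} (h₀ : ∀ i, 0 ≤ w₀ i) (h₁ : ∀ i, 0 ≤ w₁ i)
    (s₀ : ∑ i, w₀ i = 1) (s₁ : ∑ i, w₁ i = 1) {pt : ι → X} (hpt : pt.Injective) {m n : ℕ}
    (s : (Fin m → ι) × (Fin n → ι)) :
    samples (discrete w₀ h₀ s₀ pt) (discrete w₁ h₁ s₁ pt) m n {samplePoints pt s} =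
      ENNReal.ofReal (sampleWeight w₀ w₁ s) := by
  have key : ∀ {w : ι → ℝ} (h : ∀ i, 0 ≤ w i) (hs : ∑ i, w i = 1) {l : ℕ} (u : Fin l → ι),
      iid (discrete w h hs pt) l {pt ∘ u} = ENNReal.ofReal (∏ i, w (u i)) := by
    intro w h hs l u
    rw [iid, Measure.pi_singleton, ENNReal.ofReal_prod_of_nonneg fun _ _ => h _]
    refine Finset.prod_congr rfl fun i _ => ?_
    rw [← discrete_real_singleton (hw := h) (hw₁ := hs) hpt (u i), ofReal_measureReal]
    rfl
  rw [samplePoints, ← Set.singleton_prod_singleton, samples, Measure.prod_prod, key, key,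
    sampleWeight, ENNReal.ofReal_mul (Finset.prod_nonneg fun _ _ => h₀ _)]

end Atoms

/-! ### Hellinger affinity and Assouad's lemma -/

section Testing

/-- The overlap of two distributions of Hellinger affinity at least `31/32` is at least `3/4`. -/
theorem sum_min_ge_of_affinity {A : Type*} [Fintype A] {p q : A → ℝ} (hp : ∀ s, 0 ≤ p s)
    (hq : ∀ s, 0 ≤ q s) (hp₁ : ∑ s, p s = 1) (hq₁ : ∑ s, q s = 1)
    (hB : 31 / 32 ≤ ∑ s, √(p s * q s)) : 3 / 4 ≤ ∑ s, min (p s) (q s) := by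
  set B := ∑ s, √(p s * q s)
  have e : ∀ s, √(p s) * √(q s) = √(p s * q s) := fun s => (Real.sqrt_mul (hp s) _).symm
  have hm : ∑ s, (√(p s) - √(q s)) ^ 2 = 2 - 2 * B := by
    simp only [sub_sq, Real.sq_sqrt (hp _), Real.sq_sqrt (hq _), mul_assoc, e]
    rw [Finset.sum_add_distrib, Finset.sum_sub_distrib, ← Finset.mul_sum, hp₁, hq₁]
    ring
  have hpl : ∑ s, (√(p s) + √(q s)) ^ 2 = 2 + 2 * B := by
    simp only [add_sq, Real.sq_sqrt (hp _), Real.sq_sqrt (hq _), mul_assoc, e]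
    rw [Finset.sum_add_distrib, Finset.sum_add_distrib, ← Finset.mul_sum, hp₁, hq₁]
    ring
  have habs : ∀ s, |p s - q s| = |√(p s) - √(q s)| * (√(p s) + √(q s)) := fun s => by
    rw [← abs_of_nonneg (add_nonneg (Real.sqrt_nonneg (p s)) (Real.sqrt_nonneg (q s))), ← abs_mul]
    congr 1
    nlinarith [Real.sq_sqrt (hp s), Real.sq_sqrt (hq s)]
  have hcs := Finset.sum_mul_sq_le_sq_mul_sq Finset.univ (fun s => |√(p s) - √(q s)|)
    fun s => √(p s) + √(q s)
  simp only [← habs, sq_abs, hm, hpl] at hcs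
  -- Cauchy–Schwarz gives `(∑ |p - q|)² ≤ 4(1 - B²)`, at most `63/256 < 1/4` for `B ≥ 31/32`.
  have htv : ∑ s, |p s - q s| ≤ 1 / 2 := by
    refine abs_le_of_sq_le_sq' ?_ (by norm_num) |>.2
    nlinarith
  have hmin : ∑ s, min (p s) (q s) = 1 - (∑ s, |p s - q s|) / 2 := by
    have hmin' : ∀ s, min (p s) (q s) = 1 / 2 * (p s + q s - |p s - q s|) := fun s => by
      rcases le_total (p s) (q s) with h | h
      · rw [min_eq_left h, abs_of_nonpos (by linarith)]; ring
      · rw [min_eq_right h, abs_of_nonneg (by linarith)]; ring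
    simp only [hmin']
    rw [← Finset.mul_sum, Finset.sum_sub_distrib, Finset.sum_add_distrib, hp₁, hq₁]
    ring
  linarith

open Classical in
/-- Assouad's lemma, with losses that count only on the event `v`. -/
theorem assouad {k : ℕ} {A : Type*} [Fintype A] {p : (Fin k → Bool) → A → ℝ}
    {v : A → Prop}
    (hv : ∀ σ, ∑ s, (if v s then 0 else p σ s) ≤ 1 / 2)
    (hov : ∀ σ i, 3 / 4 ≤ ∑ s, min (p σ s) (p (Function.update σ i (!σ i)) s))
    {l : Fin k → Bool → A → ℝ} (hl : ∀ i b s, 0 ≤ l i b s)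
    (hl₁ : ∀ i b s, l i b s + l i (!b) s = 1) :
    ∃ σ, (k : ℝ) / 8 ≤ ∑ s, if v s then p σ s * ∑ i, l i (σ i) s else 0 := by
  let T : Fin k → (Fin k → Bool) → ℝ := fun i σ => ∑ s, if v s then p σ s * l i (σ i) s else 0
  let f : Fin k → (Fin k → Bool) → (Fin k → Bool) := fun i σ => Function.update σ i (!σ i)
  have hf : ∀ i, Function.Involutive (f i) := fun i σ => by simp [f]
  -- On `v` the losses of the two neighbours add up to 1, so their total risk is at least the
  -- overlap `3/4` minus the mass, at most `1/2`, outside `v`.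
  have hpair : ∀ i σ, 1 / 4 ≤ T i σ + T i (f i σ) := by
    intro i σ
    have h₁ : ∀ s, min (p σ s) (p (f i σ) s) ≤ (if v s then 0 else p σ s) +
        ((if v s then p σ s * l i (σ i) s else 0) +
          if v s then p (f i σ) s * l i (f i σ i) s else 0) := by
      intro s
      split_ifs
      · have e : f i σ i = !σ i := by simp [f]
        rw [e, zero_add]
        calc min (p σ s) (p (f i σ) s)
            = min (p σ s) (p (f i σ) s) * l i (σ i) s +
              min (p σ s) (p (f i σ) s) * l i (!σ i) s := by rw [← mul_add, hl₁, mul_one]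
          _ ≤ _ := add_le_add (mul_le_mul_of_nonneg_right (min_le_left _ _) (hl _ _ _))
            (mul_le_mul_of_nonneg_right (min_le_right _ _) (hl _ _ _))
      · simp
    have h₂ := (hov σ i).trans (Finset.sum_le_sum fun s _ => h₁ s)
    rw [Finset.sum_add_distrib, Finset.sum_add_distrib] at h₂
    linarith [hv σ]
  have hT : ∀ i, 2 ^ k / 8 ≤ ∑ σ, T i σ := by
    intro i
    have h₁ : ∑ σ, T i (f i σ) = ∑ σ, T i σ := Equiv.sum_comp (hf i).toPerm (T i)
    have h₂ : ∑ _σ : Fin k → Bool, (1 / 4 : ℝ) ≤ ∑ σ, (T i σ + T i (f i σ)) :=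
      Finset.sum_le_sum fun σ _ => hpair i σ
    rw [Finset.sum_add_distrib, h₁] at h₂
    simp at h₂
    linarith
  have hsum : ∑ _σ : Fin k → Bool, (k : ℝ) / 8 ≤ ∑ σ, ∑ i, T i σ := by
    rw [Finset.sum_comm]
    refine le_trans ?_ (Finset.sum_le_sum fun i _ => hT i)
    simp
    linarith
  obtain ⟨σ, _, hσ⟩ := Finset.exists_le_of_sum_le Finset.univ_nonempty hsum
  refine ⟨σ, hσ.trans_eq ?_⟩
  simp only [T]
  rw [Finset.sum_comm]
  refine Finset.sum_congr rfl fun s _ => ?_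
  split_ifs
  · rw [Finset.mul_sum]
  · simp

end Testing

/-! ### The hard distributions and their overlap -/

section PairsWeights

variable {k : ℕ}

/-- Weights on a base point and `k` pairs of points: `a` at the point of each pair that `σ` selects,
`b` at the other one, and the rest at the base point. -/
noncomputable def pairWeight (a b : ℝ) (σ : Fin k → Bool) : Option (Fin k × Bool) → ℝ
  | none => 1 - k * (a + b)
  | some (i, c) => if c = σ i then a else b

theorem sum_option_pairs {M : Type*} [AddCommMonoid M] (σ : Fin k → Bool)
    (f : Option (Fin k × Bool) → M) :
    ∑ j, f j = f none + ∑ i, (f (some (i, σ i)) + f (some (i, !σ i))) := by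
  rw [Fintype.sum_option, Fintype.sum_prod_type]
  congr 1
  refine Finset.sum_congr rfl fun i _ => ?_
  rw [Fintype.sum_bool]
  cases σ i
  · exact add_comm _ _
  · rfl

theorem pairWeight_nonneg {a b : ℝ} (ha : 0 ≤ a) (hb : 0 ≤ b) (hab : k * (a + b) ≤ 1)
    (σ : Fin k → Bool) (j) : 0 ≤ pairWeight a b σ j := by
  rcases j with _ | ⟨i, c⟩
  · simpa [pairWeight] using hab
  · simp only [pairWeight]; split_ifs <;> assumption

theorem sum_pairWeight (a b : ℝ) (σ : Fin k → Bool) : ∑ j, pairWeight a b σ j = 1 := by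
  rw [sum_option_pairs σ]
  simp [pairWeight]
  ring

/-- Flipping one selection exchanges the weights `a` and `b` in a single pair, whose contribution
drops from `a + b` to `2√(ab)`. -/
theorem sum_sqrt_pairWeight {a b : ℝ} (ha : 0 ≤ a) (hb : 0 ≤ b) (hab : k * (a + b) ≤ 1)
    (σ : Fin k → Bool) (i : Fin k) :
    ∑ j, √(pairWeight a b σ j * pairWeight a b (Function.update σ i (!σ i)) j) =
      1 - (√a - √b) ^ 2 := by
  have hterm : ∀ i', √(pairWeight a b σ (some (i', σ i')) *
        pairWeight a b (Function.update σ i (!σ i)) (some (i', σ i'))) +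
      √(pairWeight a b σ (some (i', !σ i')) *
        pairWeight a b (Function.update σ i (!σ i)) (some (i', !σ i'))) =
      a + b - if i' = i then (√a - √b) ^ 2 else 0 := by
    intro i'
    by_cases hi : i' = i
    · subst hi
      simp only [pairWeight, Function.update_self, if_true]
      rw [if_neg (by simp), if_neg (by simp), Real.sqrt_mul ha, Real.sqrt_mul hb]
      nlinarith [Real.sq_sqrt ha, Real.sq_sqrt hb]
    · simp only [pairWeight, Function.update_of_ne hi, if_true, if_neg hi]
      rw [if_neg (by simp), Real.sqrt_mul_self ha, Real.sqrt_mul_self hb, sub_zero]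
  rw [sum_option_pairs σ, Finset.sum_congr rfl fun i' _ => hterm i', Finset.sum_sub_distrib]
  simp only [pairWeight, Finset.sum_const, Finset.card_univ, Fintype.card_fin, nsmul_eq_mul,
    Finset.sum_ite_eq', Finset.mem_univ, if_true]
  rw [Real.sqrt_mul_self (by linarith)]
  ring

theorem one_sub_pow_ge {x y : ℝ} {l : ℕ} (hxy : x ≤ y) (hy : y ≤ 1) (hly : l * y ≤ 1 / 64) :
    63 / 64 ≤ (1 - x) ^ l := by
  have h₁ := one_add_mul_le_pow (a := -x) (by linarith) l
  have h₂ : (l : ℝ) * x ≤ l * y := by gcongr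
  rw [← sub_eq_add_neg] at h₁
  linarith

/-- Affinity is multiplicative over independent samples, so it is at least `(63/64)² ≥ 31/32`. -/
theorem overlap_pairWeight_ge {a₀ b₀ a₁ b₁ : ℝ} {σ τ : Fin k → Bool}
    (h₀ : ∀ j, 0 ≤ pairWeight a₀ b₀ σ j) (h₁ : ∀ j, 0 ≤ pairWeight a₁ b₁ σ j)
    (h₀' : ∀ j, 0 ≤ pairWeight a₀ b₀ τ j) (h₁' : ∀ j, 0 ≤ pairWeight a₁ b₁ τ j)
    {x₀ x₁ y₀ y₁ : ℝ} (e₀ : ∑ j, √(pairWeight a₀ b₀ σ j * pairWeight a₀ b₀ τ j) = 1 - x₀)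
    (e₁ : ∑ j, √(pairWeight a₁ b₁ σ j * pairWeight a₁ b₁ τ j) = 1 - x₁)
    (hxy₀ : x₀ ≤ y₀) (hxy₁ : x₁ ≤ y₁) (hy₀ : y₀ ≤ 1) (hy₁ : y₁ ≤ 1) {m n : ℕ}
    (hm : m * y₀ ≤ 1 / 64) (hn : n * y₁ ≤ 1 / 64) :
    3 / 4 ≤ ∑ s : (Fin m → Option (Fin k × Bool)) × (Fin n → Option (Fin k × Bool)),
      min (sampleWeight (pairWeight a₀ b₀ σ) (pairWeight a₁ b₁ σ) s)
        (sampleWeight (pairWeight a₀ b₀ τ) (pairWeight a₁ b₁ τ) s) := by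
  have hsum : ∀ ρ : Fin k → Bool,
      ∑ s : (Fin m → Option (Fin k × Bool)) × (Fin n → Option (Fin k × Bool)),
        sampleWeight (pairWeight a₀ b₀ ρ) (pairWeight a₁ b₁ ρ) s = 1 := fun ρ => by
    rw [sum_sampleWeight, sum_pairWeight, sum_pairWeight, one_pow, one_pow, one_mul]
  refine sum_min_ge_of_affinity (sampleWeight_nonneg h₀ h₁) (sampleWeight_nonneg h₀' h₁')
    (hsum σ) (hsum τ) ?_
  rw [Finset.sum_congr rfl fun s _ => sqrt_sampleWeight_mul h₀ h₁ h₀' h₁' s, sum_sampleWeight,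
    e₀, e₁]
  have c₀ := one_sub_pow_ge hxy₀ hy₀ hm
  have c₁ := one_sub_pow_ge hxy₁ hy₁ hn
  nlinarith

end PairsWeights

/-! ### The lower bound from pairs of points -/

section PairsBound

variable {X : Type*}

/-- The number of pairs in which `h` labels with `1` the point that `σ` selects. -/
def hits {k : ℕ} (pt : Option (Fin k × Bool) → X) (h : X → Bool) (σ : Fin k → Bool) : ℕ :=
  (Finset.univ.filter fun i => h (pt (some (i, σ i))) = true).card

theorem hits_le {k : ℕ} (pt : Option (Fin k × Bool) → X) (h : X → Bool) (σ : Fin k → Bool) :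
    hits pt h σ ≤ k := (Finset.card_le_univ _).trans_eq (Fintype.card_fin k)

theorem hits_add_hits_not {k : ℕ} (pt : Option (Fin k × Bool) → X) (h : X → Bool)
    (σ : Fin k → Bool) : hits pt h σ + hits pt h (fun i => !σ i) =
      (Finset.univ.filter fun j : Fin k × Bool => h (pt (some j)) = true).card := by
  have := sum_option_pairs σ fun j => match j with
    | none => 0
    | some j => if h (pt (some j)) = true then 1 else 0
  rw [Fintype.sum_option, zero_add, zero_add, Finset.sum_add_distrib] at this
  simp only [hits, Finset.card_filter]
  exact this.symm

variable [MeasurableSpace X] [MeasurableSingletonClass X] {H : Set (X → Bool)}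

theorem risk₀_pairWeight {k : ℕ} {pt : Option (Fin k × Bool) → X} {a b : ℝ} {σ : Fin k → Bool}
    {hw : ∀ j, 0 ≤ pairWeight a b σ j} (h : X → Bool) :
    risk₀ (discrete (pairWeight a b σ) hw (sum_pairWeight a b σ) pt) h =
      (if h (pt none) = true then 1 - k * (a + b) else 0) + hits pt h σ * a +
        hits pt h (fun i => !σ i) * b := by
  rw [risk₀_discrete, sum_option_pairs σ, Finset.sum_add_distrib]
  simp [pairWeight, hits, ← Finset.sum_filter, add_assoc]

theorem risk₁_pairWeight {k : ℕ} {pt : Option (Fin k × Bool) → X} {a b : ℝ} {σ : Fin k → Bool}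
    {hw : ∀ j, 0 ≤ pairWeight a b σ j} (h : X → Bool) (hab : k * (a + b) = 1) :
    risk₁ (discrete (pairWeight a b σ) hw (sum_pairWeight a b σ) pt) h =
      (k - hits pt h σ) * a + (k - hits pt h (fun i => !σ i)) * b := by
  have key : ∀ (x : ℝ) (τ : Fin k → Bool),
      (∑ i, if h (pt (some (i, τ i))) = false then x else 0) = (k - hits pt h τ) * x := by
    intro x τ
    have : ∀ i, (if h (pt (some (i, τ i))) = false then x else 0) =
        x - if h (pt (some (i, τ i))) = true then x else 0 := fun i => by
      cases h (pt (some (i, τ i))) <;> simp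
    simp_rw [this, Finset.sum_sub_distrib]
    simp [hits, ← Finset.sum_filter, sub_mul]
  rw [risk₁_discrete, sum_option_pairs σ, Finset.sum_add_distrib, ← key a σ,
    ← key b fun i => !σ i]
  simp [pairWeight, hab]

theorem sq_sqrt_sub_sqrt_add_le {a η : ℝ} (ha : 0 ≤ a) (hη : 0 ≤ η) :
    (√a - √(a + η)) ^ 2 ≤ η := by
  have h₁ : √a ≤ √(a + η) := Real.sqrt_le_sqrt (by linarith)
  nlinarith [Real.sq_sqrt ha, Real.sq_sqrt (add_nonneg ha hη), Real.sqrt_nonneg a]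

theorem sq_sqrt_sub_sqrt_le {κ γ : ℝ} (hκ : 0 < κ) (hγ₀ : 0 ≤ γ) (hγ₁ : γ ≤ 1) :
    (√((1 + γ) / (2 * κ)) - √((1 - γ) / (2 * κ))) ^ 2 ≤ γ ^ 2 / κ := by
  have ha : 0 ≤ (1 + γ) / (2 * κ) := by positivity
  have hb : 0 ≤ (1 - γ) / (2 * κ) := div_nonneg (by linarith) (by positivity)
  have h₁ : √((1 + γ) / (2 * κ)) * √((1 - γ) / (2 * κ)) = √(1 - γ ^ 2) / (2 * κ) := by
    rw [← Real.sqrt_mul ha, div_mul_div_comm, ← sq, Real.sqrt_div' _ (by positivity),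
      Real.sqrt_sq (by positivity)]
    ring_nf
  have h₂ : 1 - γ ^ 2 ≤ √(1 - γ ^ 2) := by
    refine Real.le_sqrt_of_sq_le ?_
    nlinarith [mul_nonneg (sq_nonneg γ) (sub_nonneg.2 (pow_le_one₀ hγ₀ hγ₁ : γ ^ 2 ≤ 1))]
  have h₃ : (1 - γ ^ 2) / (2 * κ) ≤ √(1 - γ ^ 2) / (2 * κ) := by gcongr
  rw [sub_sq, Real.sq_sqrt ha, Real.sq_sqrt hb, mul_assoc, h₁]
  have e : (1 + γ) / (2 * κ) + (1 - γ) / (2 * κ) - 2 * ((1 - γ ^ 2) / (2 * κ)) = γ ^ 2 / κ := by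
    field_simp; ring
  linarith

/-- The surcharge `η` on unselected points breaks the tie `k ε₀ = α`, in which `k + 1` ones would
otherwise be feasible. It must be small enough that the first sample reveals almost nothing (`m η ≤
1/64`) and that feasibility of hypotheses equal to 1 at the base point is unaffected; only finitely
many counts `a` occur. -/
theorem exists_small_shift {α ε₀ : ℝ} (hα : α < 1 / 2) (hε₀ : 0 < ε₀) (k m : ℕ) :
    ∃ η : ℝ, 0 < η ∧ k * η ≤ ε₀ ∧ 2 * α + k * η ≤ 1 ∧ m * η ≤ 1 / 64 ∧
      ∀ a : ℕ, a ≤ 2 * k → α + ε₀ < 1 - 2 * α + a * (α / k) →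
        α + ε₀ < 1 - 2 * α - k * η + a * (α / k) := by
  have hlim : ∀ c : ℝ, Filter.Tendsto (fun η : ℝ => c * η) (nhdsWithin 0 (Set.Ioi 0)) (nhds 0) := by
    intro c
    have : Filter.Tendsto (fun η : ℝ => c * η) (nhds 0) (nhds (c * 0)) :=
      Filter.Tendsto.const_mul c Filter.tendsto_id
    rw [mul_zero] at this
    exact this.mono_left nhdsWithin_le_nhds
  have hpos : ∀ᶠ η : ℝ in nhdsWithin 0 (Set.Ioi 0), 0 < η := self_mem_nhdsWithin
  have hgap : ∀ᶠ η : ℝ in nhdsWithin 0 (Set.Ioi 0), ∀ a : Fin (2 * k + 1),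
      α + ε₀ < 1 - 2 * α + (a : ℕ) * (α / k) →
        α + ε₀ < 1 - 2 * α - k * η + (a : ℕ) * (α / k) := by
    rw [Filter.eventually_all]
    intro a
    by_cases h : α + ε₀ < 1 - 2 * α + (a : ℕ) * (α / k)
    · filter_upwards [(hlim k).eventually_lt_const (sub_pos.2 h)] with η hη _
      linarith
    · exact Filter.Eventually.of_forall fun _ h' => absurd h' h
  obtain ⟨η, h₁, h₂, h₃, h₄, h₅⟩ := (hpos.and (((hlim k).eventually_lt_const hε₀).and
    (((hlim k).eventually_lt_const (show 0 < 1 - 2 * α by linarith)).and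
    (((hlim m).eventually_lt_const (show (0 : ℝ) < 1 / 64 by norm_num)).and hgap)))).exists
  exact ⟨η, h₁, h₂.le, by linarith, h₄.le, fun a ha => h₅ ⟨a, by omega⟩⟩

set_option maxHeartbeats 800000 in
open Classical in
/-- A lower bound on the minimax risk of a class that, while vanishing at a base point, realizes all
ways to select one point from each of `k` pairs. -/
theorem le_minimaxRisk_of_pairs {k : ℕ} (hk : 0 < k) {pt : Option (Fin k × Bool) → X}
    (hpt : pt.Injective)
    (hH : ∀ σ : Fin k → Bool, ∃ h ∈ H, h (pt none) = false ∧
      ∀ i c, h (pt (some (i, c))) = decide (c = σ i))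
    {α ε₀ δ₀ : ℝ} (hα₀ : 0 < α) (hα : α < 1 / 2) (hε₀ : 0 < ε₀) (hkε : k * ε₀ ≤ α) (hδ₀ : 0 ≤ δ₀)
    (hδ : δ₀ ≤ 1 / 2) {m n : ℕ} (hkn : k ≤ n) :
    ENNReal.ofReal (√(k / n) / 64) ≤ minimaxRisk H α ε₀ δ₀ m n := by
  have hk' : (0 : ℝ) < k := by exact_mod_cast hk
  have hn' : (0 : ℝ) < n := by exact_mod_cast hk.trans_le hkn
  obtain ⟨η, hη, hη₁, hη₂, hη₃, hgap⟩ := exists_small_shift hα hε₀ k m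
  -- Chosen so that `n γ²/k = 1/64`, the affinity budget of the second sample.
  set γ := √(k / n) / 8 with hγ
  have hγ0 : 0 ≤ γ := by positivity
  have hγ2 : γ ^ 2 = k / n / 64 := by
    rw [hγ, div_pow, Real.sq_sqrt (by positivity)]; norm_num
  have hγ1 : γ ≤ 1 := by
    have : (k : ℝ) / n ≤ 1 := (div_le_one hn').2 (by exact_mod_cast hkn)
    nlinarith
  have hγs : γ ^ 2 ≤ 1 := pow_le_one₀ hγ0 hγ1
  -- the weights under `μ₀` and `μ₁`
  have hq : (k : ℝ) * (α / k + (α / k + η)) = 2 * α + k * η := by field_simp; ring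
  have hg : (k : ℝ) * ((1 + γ) / (2 * k) + (1 - γ) / (2 * k)) = 1 := by field_simp; ring
  have ha₁ : 0 ≤ (1 + γ) / (2 * k) := by positivity
  have hb₁ : 0 ≤ (1 - γ) / (2 * k) := div_nonneg (by linarith) (by positivity)
  have ha₀ : 0 ≤ α / k := by positivity
  have hb₀ : 0 ≤ α / k + η := by positivity
  have hw₀ : ∀ σ : Fin k → Bool, ∀ j, 0 ≤ pairWeight (α / k) (α / k + η) σ j :=
    pairWeight_nonneg ha₀ hb₀ (by rw [hq]; exact hη₂)
  have hw₁ : ∀ σ : Fin k → Bool, ∀ j, 0 ≤ pairWeight ((1 + γ) / (2 * k)) ((1 - γ) / (2 * k)) σ j :=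
    pairWeight_nonneg ha₁ hb₁ hg.le
  let μ₀ : (Fin k → Bool) → ProbabilityMeasure X := fun σ =>
    discrete _ (hw₀ σ) (sum_pairWeight _ _ σ) pt
  let μ₁ : (Fin k → Bool) → ProbabilityMeasure X := fun σ =>
    discrete _ (hw₁ σ) (sum_pairWeight _ _ σ) pt
  -- the hypotheses that are feasible for all `σ` simultaneously
  let tot : (X → Bool) → ℕ := fun h =>
    (Finset.univ.filter fun j : Fin k × Bool => h (pt (some j)) = true).card
  let V : (X → Bool) → Prop := fun h => tot h ≤ k ∧
    (if h (pt none) = true then 1 - 2 * α else 0) + tot h * (α / k) ≤ α + ε₀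
  have hr₀ : ∀ σ h, risk₀ (μ₀ σ) h = (if h (pt none) = true then 1 - 2 * α - k * η else 0) +
      tot h * (α / k) + hits pt h (fun i => !σ i) * η := by
    intro σ h
    simp only [μ₀, tot, risk₀_pairWeight, hq, ← hits_add_hits_not pt h σ]
    push_cast
    split_ifs <;> ring
  have htot2 : ∀ h, tot h ≤ 2 * k := fun h =>
    (Finset.card_le_univ _).trans_eq (by simp [mul_comm])
  have hV_level : ∀ σ, ∀ h ∈ H, V h → h ∈ level H (α + ε₀) (μ₀ σ) := by
    rintro σ h hh ⟨hV₁, hV₂⟩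
    refine ⟨hh, ?_⟩
    have hle : (hits pt h (fun i => !σ i) : ℝ) ≤ k := by exact_mod_cast hits_le pt h _
    have hle' : hits pt h (fun i => !σ i) * η ≤ k * η := by gcongr
    rw [hr₀]
    split_ifs at hV₂ ⊢
    · linarith
    · have : (tot h : ℝ) * (α / k) ≤ k * (α / k) := by gcongr
      have e : (k : ℝ) * (α / k) = α := by field_simp
      linarith
  have hlevel_V : ∀ σ, ∀ h ∈ level H (α + ε₀) (μ₀ σ), V h := by
    intro σ h hh
    have hr := hh.2
    rw [hr₀] at hr
    have hnn : 0 ≤ hits pt h (fun i => !σ i) * η := by positivity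
    refine ⟨?_, ?_⟩
    · by_contra! hlt
      have h₁ := hits_add_hits_not pt h σ
      have h₂ := hits_le pt h σ
      -- Only `k` points are selected, so a further one carries the surcharge `η`, and the risk
      -- strictly exceeds `α + α/k ≥ α + ε₀`.
      have h₃ : 1 ≤ hits pt h (fun i => !σ i) := by
        change _ = tot h at h₁
        omega
      have h₃' : (1 : ℝ) ≤ hits pt h (fun i => !σ i) := by exact_mod_cast h₃
      have h₄ : (k + 1 : ℝ) * (α / k) ≤ tot h * (α / k) := by
        gcongr; exact_mod_cast hlt
      have h₅ : (k + 1 : ℝ) * (α / k) = α + α / k := by field_simp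
      have h₆ : ε₀ ≤ α / k := by rw [le_div_iff₀ hk']; linarith
      have h₇ : 0 ≤ if h (pt none) = true then 1 - 2 * α - k * η else 0 := by
        split_ifs <;> linarith
      nlinarith
    · split_ifs at hr ⊢
      · by_contra! hlt
        have := hgap _ (htot2 h) hlt
        linarith
      · linarith
  have hbest : ∀ σ, ∃ g ∈ level H α (μ₀ σ), risk₁ (μ₁ σ) g = (1 - γ) / 2 := by
    intro σ
    obtain ⟨g, hgH, hg₀, hgσ⟩ := hH σ
    have e₁ : hits pt g σ = k := by simp [hits, hgσ]
    have e₂ : hits pt g (fun i => !σ i) = 0 := by simp [hits, hgσ]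
    refine ⟨g, ⟨hgH, ?_⟩, ?_⟩
    · simp only [μ₀, risk₀_pairWeight, e₁, e₂, hg₀]
      have : (k : ℝ) * (α / k) = α := by field_simp
      simp [this]
    · simp only [μ₁, risk₁_pairWeight _ hg, e₁, e₂]
      field_simp
      simp
  -- The loss is 0, 1/2 or 1, according to how `h` labels the pair; symmetrizing makes the losses of
  -- the two selections add up to exactly 1.
  let l : (X → Bool) → Fin k → Bool → ℝ := fun h i c =>
    (1 - (if h (pt (some (i, c))) = true then 1 else 0) +
      if h (pt (some (i, !c))) = true then 1 else 0) / 2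
  have hexcess : ∀ σ h, V h →
      γ / k * ∑ i, l h i (σ i) ≤ excessRisk H α (μ₀ σ) (μ₁ σ) h := by
    intro σ h hV
    obtain ⟨g, hg', hgr⟩ := hbest σ
    refine le_trans ?_ (sub_le_excessRisk h hg')
    have hsum : ∑ i, l h i (σ i) = (k - hits pt h σ + hits pt h (fun i => !σ i)) / 2 := by
      simp only [l]
      rw [← Finset.sum_div, Finset.sum_add_distrib, Finset.sum_sub_distrib]
      simp [hits]
    have hle : (hits pt h σ : ℝ) + hits pt h (fun i => !σ i) ≤ k := by
      have := hits_add_hits_not pt h σ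
      exact_mod_cast this.trans_le hV.1
    rw [hgr, hsum]
    simp only [μ₁, risk₁_pairWeight _ hg]
    rw [div_mul_eq_mul_div, div_le_iff₀ hk']
    have e : ((k - hits pt h σ) * ((1 + γ) / (2 * k)) +
        (k - hits pt h (fun i => !σ i)) * ((1 - γ) / (2 * k)) - (1 - γ) / 2) * (k : ℝ) =
        ((k - hits pt h σ) * (1 + γ) - hits pt h (fun i => !σ i) * (1 - γ)) / 2 := by
      field_simp; ring
    rw [e]
    -- The difference of the two sides is half of `k` minus the number of ones, nonnegative by `V`:
    -- without the `μ₀` constraint, labelling everything 1 would cost nothing.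
    nlinarith
  refine le_iInf₂ fun hhat hhat_mem => ?_
  let p : (Fin k → Bool) → (Fin m → Option (Fin k × Bool)) × (Fin n → Option (Fin k × Bool)) → ℝ :=
    fun σ => sampleWeight (pairWeight (α / k) (α / k + η) σ)
      (pairWeight ((1 + γ) / (2 * k)) ((1 - γ) / (2 * k)) σ)
  have hp₀ : ∀ σ s, 0 ≤ p σ s := fun σ s => sampleWeight_nonneg (hw₀ σ) (hw₁ σ) s
  have hp₁ : ∀ σ, ∑ s, p σ s = 1 := fun σ => by
    simp only [p]
    rw [sum_sampleWeight, sum_pairWeight, sum_pairWeight]; simp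
  have hP : ∀ σ s, samples (μ₀ σ) (μ₁ σ) m n {samplePoints pt s} = ENNReal.ofReal (p σ s) :=
    fun σ s => samples_samplePoints (hw₀ σ) (hw₁ σ) _ _ hpt s
  have hpairs : ∀ σ, (μ₀ σ, μ₁ σ) ∈ pairs H α := fun σ =>
    let ⟨g, hg', _⟩ := hbest σ
    ⟨g, hg'⟩
  let v : (Fin m → Option (Fin k × Bool)) × (Fin n → Option (Fin k × Bool)) → Prop := fun s =>
    V (hhat (samplePoints pt s))
  have hv : ∀ σ, ∑ s, (if v s then 0 else p σ s) ≤ 1 / 2 := by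
    intro σ
    have h₁ := sum_weight_le_of_measure_le (samplePoints_injective hpt m n) (hp₀ σ) (hP σ) hδ₀
      (hhat_mem _ (hpairs σ))
    refine (Finset.sum_le_sum fun s _ => ?_).trans (h₁.trans hδ)
    by_cases hs : (hhat (samplePoints pt s) : X → Bool) ∈ level H (α + ε₀) (μ₀ σ)
    · have hvs : v s := hlevel_V σ _ hs
      rw [if_pos hvs]
      split_ifs
      exacts [hp₀ _ _, le_rfl]
    · have hs' : samplePoints pt s ∈
          {S | (hhat S : X → Bool) ∉ level H (α + ε₀) (μ₀ σ, μ₁ σ).1} := hs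
      rw [if_pos hs']
      split_ifs
      exacts [hp₀ _ _, le_rfl]
  have hov : ∀ σ i, 3 / 4 ≤ ∑ s, min (p σ s) (p (Function.update σ i (!σ i)) s) := by
    intro σ i
    have hη1 : η ≤ 1 := by
      have : (1 : ℝ) ≤ k := by exact_mod_cast hk
      have := le_mul_of_one_le_left hη.le this
      linarith
    have hγk : γ ^ 2 / k ≤ 1 := by
      rw [div_le_one hk']
      have : (1 : ℝ) ≤ k := by exact_mod_cast hk
      linarith
    have hB' : (n : ℝ) * (γ ^ 2 / k) = 1 / 64 := by rw [hγ2]; field_simp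
    exact overlap_pairWeight_ge (hw₀ _) (hw₁ _) (hw₀ _) (hw₁ _)
      (sum_sqrt_pairWeight ha₀ hb₀ (by rw [hq]; exact hη₂) σ i)
      (sum_sqrt_pairWeight ha₁ hb₁ hg.le σ i)
      (sq_sqrt_sub_sqrt_add_le ha₀ hη.le) (sq_sqrt_sub_sqrt_le hk' hγ0 hγ1) hη1 hγk hη₃ hB'.le
  obtain ⟨σ, hσ⟩ := assouad (v := v) (fun σ => by convert hv σ) hov (l := fun i c s => l (hhat (samplePoints pt s)) i c)
    (fun i c s => by simp only [l]; split_ifs <;> norm_num)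
    (fun i c s => by simp only [l, Bool.not_not]; ring)
  refine le_trans ?_ (le_iSup₂_of_le (μ₀ σ, μ₁ σ) (hpairs σ)
    (sum_le_outerExp (samplePoints_injective hpt m n) _))
  have e : √(k / n) / 64 = γ / k * (k / 8) := by rw [hγ]; field_simp; norm_num
  rw [e]
  refine (ENNReal.ofReal_le_ofReal (mul_le_mul_of_nonneg_left hσ (by positivity))).trans ?_
  rw [Finset.mul_sum, ENNReal.ofReal_sum_of_nonneg]
  · refine Finset.sum_le_sum fun s _ => ?_
    rw [hP]
    split_ifs with hs
    · have hmem : samplePoints pt s ∈ {S | (hhat S : X → Bool) ∈ level H (α + ε₀) (μ₀ σ)} :=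
        hV_level σ _ (hhat _).2 hs
      rw [Set.indicator_of_mem hmem, ← ENNReal.ofReal_mul (hp₀ _ _)]
      refine ENNReal.ofReal_le_ofReal ?_
      rw [mul_left_comm]
      exact mul_le_mul_of_nonneg_left (hexcess σ _ hs) (hp₀ _ _)
    · simp
  · intro s _
    refine mul_nonneg (by positivity) ?_
    split_ifs
    · refine mul_nonneg (hp₀ _ _) (Finset.sum_nonneg fun i _ => ?_)
      simp only [l]; split_ifs <;> norm_num
    · exact le_rfl

end PairsBound

/-! ### Pairs of points inside a class, and upper bounds in chains -/

section Configurations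

variable {X : Type*} {H : Set (X → Bool)}

theorem exists_pairs_of_shatters {s : Finset X} (hs : Shatters H s) {k : ℕ}
    (hk : 2 * k + 1 ≤ s.card) : ∃ pt : Option (Fin k × Bool) → X, pt.Injective ∧
      ∀ σ : Fin k → Bool, ∃ h ∈ H, h (pt none) = false ∧
        ∀ i c, h (pt (some (i, c))) = decide (c = σ i) := by
  obtain ⟨f⟩ : Nonempty (Option (Fin k × Bool) ↪ s) :=
    Function.Embedding.nonempty_of_card_le (by simp; omega)
  let pt : Option (Fin k × Bool) → X := fun j => f j
  have hpt : pt.Injective := Subtype.val_injective.comp f.injective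
  refine ⟨pt, hpt, fun σ => ?_⟩
  let lab : Option (Fin k × Bool) → Bool := fun j => match j with
    | none => false
    | some (i, c) => decide (c = σ i)
  obtain ⟨h, hh, e⟩ := hs (Function.extend pt lab fun _ => false)
  have e' : ∀ j, h (pt j) = lab j := fun j => by
    rw [e (pt j) (f j).2, hpt.extend_apply]
  exact ⟨h, hh, e' none, fun i c => e' (some (i, c))⟩

theorem SeparatesThreePoints.exists_pairs (hH : SeparatesThreePoints H) :
    ∃ pt : Option (Fin 1 × Bool) → X, pt.Injective ∧
      ∀ σ : Fin 1 → Bool, ∃ h ∈ H, h (pt none) = false ∧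
        ∀ i c, h (pt (some (i, c))) = decide (c = σ i) := by
  obtain ⟨h₁, hh₁, h₂, hh₂, x₀, x₁, x₂, ⟨a₀, b₀⟩, a₁, b₂, a₂, b₁⟩ := hH
  have h01 : x₀ ≠ x₁ := fun h => by simp [← h, a₀] at a₁
  have h02 : x₀ ≠ x₂ := fun h => by simp [← h, b₀] at b₂
  have h12 : x₁ ≠ x₂ := fun h => by simp [← h, a₁] at a₂
  let pt : Option (Fin 1 × Bool) → X := fun j => match j with
    | none => x₀
    | some (_, c) => if c then x₁ else x₂
  refine ⟨pt, ?_, fun σ => ?_⟩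
  · rintro (_ | ⟨i, c⟩) (_ | ⟨i', c'⟩) h
    · rfl
    · cases c'
      exacts [absurd h h02, absurd h h01]
    · cases c
      exacts [absurd h.symm h02, absurd h.symm h01]
    · rw [Subsingleton.elim i i']
      cases c <;> cases c'
      exacts [rfl, absurd h.symm h12, absurd h h12, rfl]
  · rcases hσ : σ 0
    · refine ⟨h₂, hh₂, b₀, fun i c => ?_⟩
      rw [Subsingleton.elim i 0, hσ]
      cases c <;> simp [pt, b₁, b₂]
    · refine ⟨h₁, hh₁, a₀, fun i c => ?_⟩
      rw [Subsingleton.elim i 0, hσ]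
      cases c <;> simp [pt, a₁, a₂]

theorem SeparatesThreePoints.one_le (hH : SeparatesThreePoints H) {d : ℕ} (hd : HasVCDim H d) :
    1 ≤ d := by
  obtain ⟨h₁, hh₁, h₂, hh₂, _, x₁, _, _, a₁, _, _, b₁⟩ := hH
  exact one_le_of_ne hd hh₁ hh₂ (x := x₁) (by simp [a₁, b₁])

/-- A shattered set of size `d` provides a base point and `(d-1)/2` pairs. For `d ≤ 2` that gives no
pair, and the separated triple supplies one. -/
theorem SeparatesThreePoints.exists_many_pairs (hH : SeparatesThreePoints H) {d : ℕ}
    (hd : HasVCDim H d) : ∃ k : ℕ, 0 < k ∧ k ≤ d ∧ d ≤ 4 * k ∧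
      ∃ pt : Option (Fin k × Bool) → X, pt.Injective ∧
        ∀ σ : Fin k → Bool, ∃ h ∈ H, h (pt none) = false ∧
          ∀ i c, h (pt (some (i, c))) = decide (c = σ i) := by
  have h1 := hH.one_le hd
  rcases le_or_gt d 2 with h2 | h2
  · exact ⟨1, one_pos, h1, by omega, hH.exists_pairs⟩
  · obtain ⟨s, hs, hsh⟩ := hd.1
    exact ⟨(d - 1) / 2, by omega, by omega, by omega,
      exists_pairs_of_shatters hsh (by rw [hs]; omega)⟩

/-- Finitely many members of a nested family are below a common member. -/
theorem exists_upper_bound {G F : Set (X → Bool)} (hG : G.Nonempty)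
    (hnest : ∀ h ∈ G, ∀ h' ∈ G,
      (∀ y, h y = false → h' y = false) ∨ ∀ y, h' y = false → h y = false)
    (hF : F.Finite) (hFG : F ⊆ G) : ∃ g ∈ G, ∀ h ∈ F, ∀ y, g y = false → h y = false := by
  induction F, hF using Set.Finite.induction_on with
  | empty =>
    obtain ⟨g, hg⟩ := hG
    exact ⟨g, hg, by simp⟩
  | @insert h F _ _ ih =>
    obtain ⟨g, hg, hgF⟩ := ih ((Set.subset_insert h F).trans hFG)
    have hh := hFG (Set.mem_insert h F)
    rcases hnest g hg h hh with hle | hle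
    · refine ⟨g, hg, ?_⟩
      rintro h' (rfl | hh') y hy
      exacts [hle y hy, hgF h' hh' y hy]
    · refine ⟨h, hh, ?_⟩
      rintro h' (rfl | hh') y hy
      exacts [hy, hgF h' hh' y (hle y hy)]

end Configurations

/-! ### The lower bound of order `1/n` -/

section Lower

variable {X : Type*} [MeasurableSpace X] {H : Set (X → Bool)}

theorem mul_measure_le_outerExp {Ω : Type*} [MeasurableSpace Ω] (P : Measure Ω) {F : Ω → ℝ≥0∞}
    {c : ℝ≥0∞} {B : Set Ω} (hB : ∀ ω ∈ B, c ≤ F ω) : c * P B ≤ outerExp P F := by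
  refine le_iInf₂ fun g hg => le_iInf fun hFg => ?_
  refine le_trans ?_ (mul_meas_ge_le_lintegral hg c)
  exact mul_le_mul_right (measure_mono fun ω hω => (hB ω hω).trans (hFg ω)) c

theorem iid_exists_le (μ : ProbabilityMeasure X) (m : ℕ) {B : Set X} (hB : MeasurableSet B) :
    iid μ m {S | ∃ i, S i ∈ B} ≤ m * (μ : Measure X) B := by
  have e : {S : Fin m → X | ∃ i, S i ∈ B} = ⋃ i, (fun S => S i) ⁻¹' B := by ext; simp
  rw [e]
  refine (measure_iUnion_fintype_le _ _).trans_eq ?_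
  have : ∀ i : Fin m, iid μ m ((fun S => S i) ⁻¹' B) = (μ : Measure X) B := fun i =>
    (measurePreserving_eval (fun _ : Fin m => (μ : Measure X)) i).measure_preimage
      hB.nullMeasurableSet
  simp [this]

variable [MeasurableSingletonClass X]

/-- The adversary fixes `μ₀` first, lists the learner's feasible outputs on second samples
constantly equal to `t`, and hides `μ₁`-mass where all of them vanish but some member of the chain
does not. -/
theorem le_minimaxRisk_of_not_admitsMaximal (hsep : ¬ SeparatesThreePoints H) {t s : X}
    (hne : {h ∈ H | h t = false ∧ h s = false}.Nonempty)
    (hmax : ¬ AdmitsMaximal {h ∈ H | h t = false ∧ h s = false}) {α ε₀ δ₀ : ℝ} (hα : 0 ≤ α)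
    (hε₀ : 0 ≤ ε₀) (hαε : α + ε₀ < 1 / 2) (hδ : δ₀ ≤ 1 / 2) {m n : ℕ} (hn : 0 < n) :
    ENNReal.ofReal (1 / (16 * n)) ≤ minimaxRisk H α ε₀ δ₀ m n := by
  set G := {h ∈ H | h t = false ∧ h s = false} with hG
  have hn' : (0 : ℝ) < n := by exact_mod_cast hn
  have hn1 : (1 : ℝ) ≤ n := by exact_mod_cast hn
  have hlev : level H α (twoPoint t s) = G := level_twoPoint hα (by linarith) t s
  have hlev' : level H (α + ε₀) (twoPoint t s) = G := level_twoPoint (by linarith) hαε t s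
  refine le_iInf₂ fun hhat hhat_mem => ?_
  -- the outputs on a constant second sample are finitely many
  let F : Set (X → Bool) := {g ∈ G | ∃ u : Fin m → X, (∀ i, u i ∈ ({t, s} : Set X)) ∧
    g = hhat (u, fun _ => t)}
  have hF : F.Finite := by
    have hfin : (Set.pi Set.univ fun _ : Fin m => ({t, s} : Set X)).Finite :=
      Set.Finite.pi fun _ => Set.toFinite _
    refine (hfin.image fun u => (hhat (u, fun _ => t) : X → Bool)).subset ?_
    rintro g ⟨_, u, hu, rfl⟩
    exact ⟨u, fun i _ => hu i, rfl⟩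
  obtain ⟨g, hg, hgF⟩ := exists_upper_bound hne (fun h hh h' hh' =>
    nested_of_common_zero hsep hh.1 hh'.1 hh.2.1 hh'.2.1) hF fun h hh => hh.1
  obtain ⟨h', hh', y, hy', hy⟩ : ∃ h' ∈ G, ∃ y, h' y = true ∧ g y = false := by
    by_contra! hcon
    exact hmax ⟨g, hg, fun h' hh' y hy => by simpa using hcon h' hh' y hy⟩
  -- The second sample avoids `y` with probability at least `1 - n w = 3/4`. Subtracting `δ₀ ≤ 1/2`
  -- leaves `1/4`, and the loss there is at least `w`.
  set w : ℝ := 1 / (4 * n) with hw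
  have hw0 : 0 < w := by positivity
  have hw1 : w ≤ 1 := by rw [hw, div_le_one (by positivity)]; linarith
  let μ₁ : ProbabilityMeasure X := discrete (fun b : Bool => if b then 1 - w else w)
    (fun b => by cases b <;> simp [hw0.le, hw1]) (by simp) fun b => if b then t else y
  have hp : (twoPoint t s, μ₁) ∈ pairs H α := by
    change (level H α (twoPoint t s)).Nonempty
    rwa [hlev]
  set P := samples (twoPoint t s) μ₁ m n
  let B : Set ((Fin m → X) × (Fin n → X)) := {S | (hhat S : X → Bool) ∈ G ∧
    (∀ i, S.1 i ∈ ({t, s} : Set X)) ∧ ∀ i, S.2 i = t}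
  have hPB : ENNReal.ofReal (1 / 4) ≤ P B := by
    have hc : (Set.univ : Set ((Fin m → X) × (Fin n → X))) ⊆
        B ∪ ({S | (hhat S : X → Bool) ∉ level H (α + ε₀) (twoPoint t s)} ∪
          ({S | S.1 ∈ {u | ∃ i, u i ∈ ({t, s} : Set X)ᶜ}} ∪
            {S | S.2 ∈ {u | ∃ i, u i ∈ ({t} : Set X)ᶜ}})) := by
      intro S _
      by_contra hcon
      simp only [Set.mem_union, not_or] at hcon
      obtain ⟨h₀, h₁, h₂, h₃⟩ := hcon
      refine h₀ ⟨?_, fun i => ?_, fun i => ?_⟩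
      · rw [← hlev']; exact not_not.1 h₁
      · by_contra hi; exact h₂ ⟨i, hi⟩
      · by_contra hi; exact h₃ ⟨i, hi⟩
    have hle := (measure_mono (μ := P) hc).trans ((measure_union_le _ _).trans
      (add_le_add_right ((measure_union_le _ _).trans
        (add_le_add_right (measure_union_le _ _) _)) _))
    have b₁ : P {S | (hhat S : X → Bool) ∉ level H (α + ε₀) (twoPoint t s)} ≤
        ENNReal.ofReal (1 / 2) := (hhat_mem _ hp).trans (ENNReal.ofReal_le_ofReal hδ)
    have b₂ : P {S | S.1 ∈ {u | ∃ i, u i ∈ ({t, s} : Set X)ᶜ}} ≤ 0 := by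
      rw [samples_fst_preimage]
      refine (iid_exists_le _ _ ((Set.toFinite _).measurableSet.compl)).trans_eq ?_
      have : (twoPoint t s : Measure X) ({t, s} : Set X)ᶜ = 0 := by
        rw [← measureReal_eq_zero_iff, twoPoint, discrete_real]
        exact Finset.sum_eq_zero fun b _ => by cases b <;> simp
      rw [this, mul_zero]
    have b₃ : P {S | S.2 ∈ {u | ∃ i, u i ∈ ({t} : Set X)ᶜ}} ≤ ENNReal.ofReal (1 / 4) := by
      rw [samples_snd_preimage]
      refine (iid_exists_le _ _ (measurableSet_singleton t).compl).trans ?_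
      have : (μ₁ : Measure X).real ({t} : Set X)ᶜ ≤ w := by
        rw [discrete_real]
        rw [Fintype.sum_bool, if_neg (by simp), zero_add]
        by_cases hyt : y = t <;> simp [hyt, hw0.le]
      rw [← ofReal_measureReal, ← ENNReal.ofReal_natCast, ← ENNReal.ofReal_mul (by positivity)]
      refine ENNReal.ofReal_le_ofReal ?_
      calc (n : ℝ) * (μ₁ : Measure X).real ({t} : Set X)ᶜ ≤ n * w := by gcongr
        _ = 1 / 4 := by rw [hw]; field_simp
    have htot : (1 : ℝ≥0∞) ≤ P B + ENNReal.ofReal (3 / 4) := by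
      rw [measure_univ] at hle
      refine hle.trans ?_
      gcongr
      refine (add_le_add b₁ (add_le_add b₂ b₃)).trans_eq ?_
      rw [zero_add, ← ENNReal.ofReal_add (by norm_num) (by norm_num)]
      norm_num
    have h1 : (1 : ℝ≥0∞) = ENNReal.ofReal (1 / 4) + ENNReal.ofReal (3 / 4) := by
      rw [← ENNReal.ofReal_add (by norm_num) (by norm_num)]; norm_num
    rw [h1] at htot
    exact (ENNReal.add_le_add_iff_right ENNReal.ofReal_ne_top).1 htot
  refine le_trans ?_ (le_iSup₂_of_le (twoPoint t s, μ₁) hp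
    (mul_measure_le_outerExp (c := ENNReal.ofReal w) (B := B) _ ?_))
  · have e : 1 / (16 * (n : ℝ)) = w * (1 / 4) := by rw [hw]; field_simp; norm_num
    rw [e, ENNReal.ofReal_mul hw0.le]
    gcongr
  · rintro S ⟨hS, hS₁, hS₂⟩
    have hmem : S ∈ {S | (hhat S : X → Bool) ∈ level H (α + ε₀) (twoPoint t s)} := by
      change (hhat S : X → Bool) ∈ level H (α + ε₀) (twoPoint t s)
      rwa [hlev']
    rw [Set.indicator_of_mem hmem]
    refine ENNReal.ofReal_le_ofReal (le_trans ?_ (sub_le_excessRisk (h := h') _ (by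
      change h' ∈ level H α (twoPoint t s)
      rwa [hlev])))
    have hSF : (hhat S : X → Bool) ∈ F := by
      refine ⟨hS, S.1, hS₁, ?_⟩
      rw [← show S.2 = fun _ => t from funext hS₂]
    have hSy := hgF _ hSF y hy
    simp only [μ₁, risk₁_discrete, Fintype.sum_bool, if_true, Bool.false_eq_true, if_false,
      hS.2.1, hSy, hh'.2.1, hy']
    simp

end Lower

end NeymanPearson

/-! ### The main theorem -/

theorem theorem2 :
    ∃ c C : ℝ, 0 < c ∧ 0 < C ∧
      ∀ (X : Type*) [MeasurableSpace X] [MeasurableSingletonClass X]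
        (H : Set (X → Bool)) (d : ℕ), NeymanPearson.IsVCClass H d →
      ∀ α δ₀ ε₀ : ℝ, 0 < α → α < 1 / 2 → 0 < δ₀ → δ₀ < 1 / 2 →
        0 < ε₀ → d * ε₀ ≤ α → α + 2 * ε₀ < 1 / 2 →
      ∀ n₀ n : ℕ, n₀ = NeymanPearson.sampleSize H (ε₀ / 2) δ₀ → 2 * d ≤ n →
      -- (i)
      (NeymanPearson.SeparatesThreePoints H →
        ENNReal.ofReal (c * √(d / n)) ≤ NeymanPearson.minimaxRisk H α ε₀ δ₀ n₀ n ∧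
        NeymanPearson.minimaxRisk H α ε₀ δ₀ n₀ n ≤
          ENNReal.ofReal (C * √(d / n * Real.log n) + δ₀)) ∧
      (¬ NeymanPearson.SeparatesThreePoints H →
        -- (ii.a)
        ((∃ μ₀ : MeasureTheory.ProbabilityMeasure X, NeymanPearson.FinitelySupported μ₀ ∧
            (NeymanPearson.level H (α + ε₀) μ₀).Nonempty ∧
            ¬ NeymanPearson.AdmitsMaximal (NeymanPearson.level H (α + ε₀) μ₀)) →
          ENNReal.ofReal (c * (d / n)) ≤ NeymanPearson.minimaxRisk H α ε₀ δ₀ n₀ n ∧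
          NeymanPearson.minimaxRisk H α ε₀ δ₀ n₀ n ≤
            ENNReal.ofReal (C * (d / n * Real.log n) + δ₀)) ∧
        -- (ii.b)
        ((∀ μ₀ : MeasureTheory.ProbabilityMeasure X, NeymanPearson.FinitelySupported μ₀ →
            (NeymanPearson.level H (α + ε₀) μ₀).Nonempty →
            NeymanPearson.AdmitsMaximal (NeymanPearson.level H (α + ε₀) μ₀)) →
          ∃ hhat ∈ NeymanPearson.approxLearners H α ε₀ δ₀ n₀ n,
            ∀ p ∈ NeymanPearson.pairs H α,
              NeymanPearson.samples p.1 p.2 n₀ n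
                {S | ¬ ((hhat S : X → Bool) ∈ NeymanPearson.level H (α + ε₀) p.1 ∧
                  NeymanPearson.excessRisk H α p.1 p.2 (hhat S) = 0)} ≤
                ENNReal.ofReal δ₀)) := by
  -- Since `d ≤ 4k`, `√(d/n)/128 ≤ √(k/n)/64`. In the nested case `d ≤ 2` leaves `d/(128 n)` well
  -- below `1/(16 n)`.
  refine ⟨1 / 128, 40, by norm_num, by norm_num, ?_⟩
  rintro X _ _ H d hH α δ₀ ε₀ hα₀ hα hδ₀ hδ hε₀ hdε hαε n₀ n rfl hn
  refine ⟨fun hsep => ?_, fun hsep => ⟨?_, fun hmax => ?_⟩⟩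
  · have hd := hsep.one_le hH.hasVCDim
    refine ⟨?_, NeymanPearson.minimaxRisk_le_sqrt hH hε₀ hδ₀ hd hn⟩
    obtain ⟨k, hk, hkd, hdk, pt, hpt, hreal⟩ := hsep.exists_many_pairs hH.hasVCDim
    have hkε : k * ε₀ ≤ α := le_trans (by gcongr) hdε
    refine le_trans (ENNReal.ofReal_le_ofReal ?_) (NeymanPearson.le_minimaxRisk_of_pairs hk hpt
      hreal hα₀ hα hε₀ hkε hδ₀.le hδ.le (by omega : k ≤ n))
    have h₁ : √((d : ℝ) / n) ≤ 2 * √((k : ℝ) / n) := by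
      rw [Real.sqrt_le_left (by positivity), mul_pow, Real.sq_sqrt (by positivity), ← mul_div_assoc]
      gcongr
      norm_num
      exact_mod_cast hdk
    linarith
  · rintro ⟨μ₀, hμ₀, hne, hmax⟩
    obtain ⟨t, s, hts⟩ := NeymanPearson.exists_level_eq hsep (by linarith) hμ₀ hne
    rw [hts] at hne hmax
    have hd : 1 ≤ d := by
      obtain ⟨h, hh⟩ := hne
      by_contra hd
      refine hmax ⟨h, hh, fun h' hh' x hx => ?_⟩
      by_contra hx'
      refine hd (NeymanPearson.one_le_of_ne hH.hasVCDim hh.1 hh'.1 (x := x) fun he => hx' ?_)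
      exact he.trans hx
    have hd2 : d ≤ 2 := by
      obtain ⟨S, hS, hsh⟩ := hH.hasVCDim.1
      exact hS ▸ NeymanPearson.card_le_two_of_shatters hsep hsh
    refine ⟨?_, NeymanPearson.minimaxRisk_le_div hH hsep hε₀ (by linarith) hδ₀ hd hn⟩
    have hn0 : 0 < n := by omega
    refine le_trans (ENNReal.ofReal_le_ofReal ?_)
      (NeymanPearson.le_minimaxRisk_of_not_admitsMaximal hsep hne hmax hα₀.le hε₀.le (by linarith)
        hδ.le hn0)
    have hn' : (0 : ℝ) < n := by exact_mod_cast hn0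
    have hd2' : (d : ℝ) ≤ 2 := by exact_mod_cast hd2
    rw [div_mul_div_comm, one_mul, div_le_div_iff₀ (by positivity) (by positivity)]
    nlinarith
  · exact NeymanPearson.exists_learner_excessRisk_eq_zero hH hsep hα₀ hε₀ (by linarith) hδ₀ n hmax
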